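/- For every prime number $p > 3$ there is a monic irreducible polynomial $T(x) \in \mathbb{Z}[x]$ of degree $p$ whose constant term is $1$ or $-1$ and all of whose complex roots are real and lie in the open interval $(-2.08,\, 2.08)$. -/

import Mathlib

/-! Let q = t³ - t - 1 and q* = t³ + t² - 1. For large m, t^m q ± q* has a root near the plastic
number θ ≈ 1.3247, the real root of q. Rewritten in x = t + 1/t, with trivial factors removed, it
gives an integer polynomial with a root near θ + 1/θ ≈ 2.0796 < 2.08. In the Chebyshev basis `S` it
becomes a combination of two consecutive `S`, so its signs at the zeros of one of them are explicit.
They alternate, which makes all roots real and puts all but the largest in [-2, 2].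

Irreducibility follows from Kronecker's theorem (`irreducible_of_no_rootOfUnity_trace_root`): a
factor missing the largest root has all its roots in [-2, 2], hence a root ζ + 1/ζ with ζ a root of
unity. To exclude these, `rootOfUnity_conjugate` supplies a conjugate -ζ, ζ² or -ζ². Eliminating ζ^m
between ζ^m q(ζ) = ±q*(ζ) and its conjugate leaves an equation free of m, so only a few cyclotomic
polynomials can occur, each for one residue class of m.

The choice of family depends on the prime. If p ≡ 1 mod 3 and p ≠ 7, `plasticAbove` works. If p ≡ 2
mod 3, `coxeterOdd` works unless p ≡ 4 mod 5, when it has a fifth root of unity; then `coxeterEven`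
of degree p + 1, divided by X + 1, replaces it. For p = 7 a factor of `coxeterOdd 7` is used. -/

/-! ### Real roots from sign changes, and irreducibility from Kronecker's theorem -/

open Polynomial in
theorem exists_roots_of_alternating {T : ℝ[X]} {p : ℕ} (hT : T.Monic) (hdeg : T.natDegree = p)
    (y : ℕ → ℝ) (hy : ∀ i < p, y (i + 1) < y i)
    (hsgn : ∀ i ≤ p, 0 < (-1) ^ i * T.eval (y i)) :
    ∃ r : ℕ → ℝ, (∀ i < p, r i ∈ Set.Ioo (y (i + 1)) (y i)) ∧
      T = ∏ i ∈ Finset.range p, (X - C (r i)) := by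
  have key : ∀ i < p, ∃ x ∈ Set.Ioo (y (i + 1)) (y i), T.eval x = 0 := by
    intro i hi
    have h1 := hsgn i hi.le
    have h2 := hsgn (i + 1) hi
    have hc : ContinuousOn (fun x => (-1) ^ i * T.eval x) (Set.Icc (y (i + 1)) (y i)) := by
      fun_prop
    have h3 : (0 : ℝ) ∈ Set.Ioo ((-1) ^ i * T.eval (y (i + 1))) ((-1) ^ i * T.eval (y i)) :=
      ⟨by rw [pow_succ] at h2; linarith, h1⟩
    obtain ⟨x, hx, hx0⟩ := intermediate_value_Ioo (hy i hi).le hc h3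
    exact ⟨x, hx, by simpa using hx0⟩
  choose! r hr hr0 using key
  refine ⟨r, hr, ?_⟩
  have hanti : ∀ i j, i < j → j < p → r j < r i := by
    intro i j hij
    induction j, hij using Nat.le_induction with
    | base => exact fun hj => (hr _ hj).2.trans (hr i (by omega)).1
    | succ j hij ih =>
      exact fun hj => ((hr _ hj).2.trans (hr j (by omega)).1).trans (ih (by omega))
  have hdvd : ∏ i ∈ Finset.range p, (X - C (r i)) ∣ T := by
    refine Finset.prod_dvd_of_coprime (fun i hi j hj hij => ?_) fun i hi => ?_
    · apply Polynomial.pairwise_coprime_X_sub_C (s := fun i : Finset.range p => r i)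
        (i := ⟨i, hi⟩) (j := ⟨j, hj⟩)
      · rintro ⟨a, ha⟩ ⟨b, hb⟩ hab
        simp only [Subtype.mk.injEq] at *
        rcases lt_trichotomy a b with h | h | h
        · exact absurd hab (hanti a b h (Finset.mem_range.1 hb)).ne'
        · exact h
        · exact absurd hab (hanti b a h (Finset.mem_range.1 ha)).ne
      · simpa using hij
    · exact dvd_iff_isRoot.2 (hr0 i (Finset.mem_range.1 hi))
  refine eq_of_monic_of_dvd_of_natDegree_le (monic_prod_of_monic _ _ fun i _ => monic_X_sub_C _)
    hT hdvd ?_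
  rw [natDegree_prod_of_monic _ _ fun i _ => monic_X_sub_C _, hdeg]
  simp

/-- The roots of z² - rz + 1 have product 1: they are complex conjugate when |r| < 2 and equal to ±1
when |r| = 2. -/
theorem Complex.norm_eq_one_of_add_inv_eq_ofReal {z : ℂ} {r : ℝ} (hr : |r| ≤ 2) (hz : z ≠ 0)
    (h : z + z⁻¹ = r) : ‖z‖ = 1 := by
  have h1 : z * z + 1 = r * z := by
    rw [← h]; field_simp
  have him := congrArg Complex.im h1
  have hre := congrArg Complex.re h1
  simp at him hre
  obtain ⟨hl, hu⟩ := abs_le.1 hr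
  have : Complex.normSq z = 1 := by
    rw [Complex.normSq_apply]
    by_cases hi : z.im = 0
    · rw [hi] at hre ⊢
      have h2 : (z.re * z.re + 1) ^ 2 = r ^ 2 * z.re ^ 2 := by
        linear_combination (z.re * z.re + 1 + r * z.re) * hre
      have h3 : r ^ 2 * z.re ^ 2 ≤ 4 * z.re ^ 2 :=
        mul_le_mul_of_nonneg_right (by nlinarith) (sq_nonneg _)
      have : (z.re ^ 2 - 1) ^ 2 ≤ 0 := by nlinarith
      nlinarith [sq_nonneg (z.re^2 - 1)]
    · have h2 : 2 * z.re = r := mul_right_cancel₀ hi (by linarith)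
      nlinarith
  rw [Complex.norm_def, this, Real.sqrt_one]

-- Solve ζ + 1/ζ = x for a root x of f. Every embedding of ℚ(ζ) sends x to a root of f, hence ζ to
-- the unit circle, and Kronecker's theorem applies to the algebraic integer ζ.
open Polynomial in
theorem exists_rootOfUnity_trace_root {f : ℤ[X]} (hf : f.Monic) (hdeg : f.natDegree ≠ 0)
    (hroots : ∀ z : ℂ, aeval z f = 0 → ∃ r : ℝ, |r| ≤ 2 ∧ z = r) :
    ∃ (ζ : ℂ) (n : ℕ), 0 < n ∧ ζ ^ n = 1 ∧ aeval (ζ + ζ⁻¹) f = 0 := by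
  obtain ⟨x, hx⟩ := IsAlgClosed.exists_aeval_eq_zero ℂ f (by
    rw [degree_eq_natDegree hf.ne_zero]; exact_mod_cast hdeg)
  obtain ⟨ζ, hζ⟩ := IsAlgClosed.exists_aeval_eq_zero ℂ (X ^ 2 - C x * X + 1 : ℂ[X]) (by
    have : (X ^ 2 - C x * X + 1 : ℂ[X]).degree = 2 := by compute_degree!
    rw [this]; norm_num)
  simp at hζ
  have hζ0 : ζ ≠ 0 := by rintro rfl; simp at hζ
  have hx' : ζ + ζ⁻¹ = x := by field_simp; linear_combination hζ
  have hxint : IsIntegral ℤ x := ⟨f, hf, by simpa [aeval_def] using hx⟩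
  have hζint : IsIntegral ℤ ζ := by
    have hxint' : x ∈ integralClosure ℤ ℂ := hxint
    have : IsIntegral (integralClosure ℤ ℂ) ζ := by
      refine ⟨X ^ 2 - C ⟨x, hxint'⟩ * X + 1, by monicity!, ?_⟩
      simp only [eval₂_add, eval₂_sub, eval₂_mul, eval₂_X_pow, eval₂_X, eval₂_C, eval₂_one]
      exact hζ
    exact isIntegral_trans _ this
  let K := IntermediateField.adjoin ℚ {ζ}
  have hζQ : IsIntegral ℚ ζ := hζint.tower_top
  have : FiniteDimensional ℚ K := IntermediateField.adjoin.finiteDimensional hζQ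
  have : NumberField K := ⟨⟩
  let w : K := ⟨ζ, IntermediateField.mem_adjoin_simple_self ℚ ζ⟩
  have hw0 : w ≠ 0 := fun h => hζ0 (congrArg Subtype.val h)
  have hwint : IsIntegral ℤ w := by
    rw [← isIntegral_algebraMap_iff (algebraMap K ℂ).injective]
    exact hζint
  have hwf : aeval (w + w⁻¹) f = 0 := by
    apply (algebraMap K ℂ).injective
    rw [← aeval_algebraMap_apply, map_zero, map_add, map_inv₀]
    change aeval (ζ + ζ⁻¹) f = 0
    rw [hx', hx]
  obtain ⟨n, hn, hwn⟩ := NumberField.Embeddings.pow_eq_one_of_norm_eq_one K ℂ hwint (by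
    intro φ
    have h1 : aeval (φ w + (φ w)⁻¹) f = 0 := by
      have := congrArg φ.toIntAlgHom hwf
      rw [← aeval_algHom_apply] at this
      simpa using this
    obtain ⟨r, hr, hr'⟩ := hroots _ h1
    exact Complex.norm_eq_one_of_add_inv_eq_ofReal hr (by simpa using hw0) hr')
  refine ⟨ζ, n, hn, ?_, by rw [hx', hx]⟩
  simpa using congrArg (algebraMap K ℂ) hwn

open Polynomial in
theorem exists_eq_of_aeval_eq_zero {T : ℤ[X]} {p : ℕ} {r : ℕ → ℝ}
    (hr : T.map (Int.castRingHom ℝ) = ∏ i ∈ Finset.range p, (X - C (r i))) {z : ℂ}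
    (hz : aeval z T = 0) : ∃ i < p, z = r i := by
  have h1 : aeval z (T.map (Int.castRingHom ℝ)) = 0 := by
    rw [← algebraMap_int_eq, aeval_map_algebraMap, hz]
  rw [hr, map_prod, Finset.prod_eq_zero_iff] at h1
  obtain ⟨i, hi, h⟩ := h1
  refine ⟨i, Finset.mem_range.1 hi, ?_⟩
  simpa [sub_eq_zero] using h

open Polynomial in
theorem irreducible_of_no_rootOfUnity_trace_root {T : ℤ[X]} {p : ℕ} (hT : T.Monic) (hp : 0 < p)
    {r : ℕ → ℝ} (hr : T.map (Int.castRingHom ℝ) = ∏ i ∈ Finset.range p, (X - C (r i)))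
    (hr2 : ∀ i, 1 ≤ i → i < p → |r i| ≤ 2) (hr0 : ∀ i, 1 ≤ i → i < p → r i ≠ r 0)
    (hcyc : ∀ (ζ : ℂ) (n : ℕ), 0 < n → ζ ^ n = 1 → aeval (ζ + ζ⁻¹) T ≠ 0) :
    Irreducible T := by
  have key : ∀ f : ℤ[X], f.Monic → f ∣ T → aeval (r 0) f ≠ 0 → f.natDegree = 0 := by
    intro f hf hfT hf0
    by_contra hdeg
    obtain ⟨ζ, n, hn, hζ, h⟩ := exists_rootOfUnity_trace_root hf hdeg (by
      intro z hz
      obtain ⟨i, hi, hzi⟩ := exists_eq_of_aeval_eq_zero hr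
        (aeval_eq_zero_of_dvd_aeval_eq_zero hfT hz)
      refine ⟨r i, hr2 i ?_ hi, hzi⟩
      rcases Nat.eq_zero_or_pos i with rfl | h
      · refine absurd ?_ hf0
        rw [hzi] at hz
        have : ((aeval (r 0) f : ℝ) : ℂ) = aeval ((r 0 : ℝ) : ℂ) f :=
          (aeval_algebraMap_apply ℂ (r 0) f).symm
        rw [hz] at this
        exact_mod_cast this
      · exact h)
    exact hcyc ζ n hn hζ (aeval_eq_zero_of_dvd_aeval_eq_zero hfT h)
  have hdegT : T.natDegree = p := by
    have := congrArg natDegree hr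
    rw [natDegree_map_eq_of_injective (RingHom.injective_int _),
      natDegree_prod_of_monic _ _ fun i _ => monic_X_sub_C _] at this
    simpa using this
  rw [hT.irreducible_iff_natDegree]
  refine ⟨fun h => ?_, fun f g hf hg hfg => ?_⟩
  · rw [h, natDegree_one] at hdegT; omega
  · by_cases hf0 : aeval (r 0) f = 0
    · right
      -- If both factors vanished at `r 0`, it would be a double root, contrary to `hr0`.
      refine key g hg ⟨f, by rw [← hfg, mul_comm]⟩ fun hg0 => ?_
      obtain ⟨p, rfl⟩ : ∃ k, p = k + 1 := ⟨p - 1, by omega⟩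
      have e : ∀ h : ℤ[X], aeval (r 0) h = 0 → X - C (r 0) ∣ h.map (Int.castRingHom ℝ) := by
        intro h hh
        rw [dvd_iff_isRoot, IsRoot, eval_map, ← algebraMap_int_eq, ← aeval_def, hh]
      obtain ⟨a, ha⟩ := e f hf0
      have hb := e g hg0
      rw [← hfg, Polynomial.map_mul, ha, mul_assoc, Finset.prod_range_succ',
        mul_comm (∏ _ ∈ _, _)] at hr
      have h1 := mul_left_cancel₀ (X_sub_C_ne_zero (r 0)) hr
      have h2 : X - C (r 0) ∣ ∏ i ∈ Finset.range p, (X - C (r (i + 1))) :=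
        h1 ▸ hb.mul_left a
      rw [dvd_iff_isRoot, IsRoot, eval_prod, Finset.prod_eq_zero_iff] at h2
      obtain ⟨i, hi, h3⟩ := h2
      have : i < p := Finset.mem_range.1 hi
      exact hr0 (i + 1) (by omega) (by omega) (by simp at h3; linarith)
    · exact Or.inl (key f hf ⟨g, hfg.symm⟩ hf0)

open Polynomial in
/-- Alternating signs at `2.08 = y 0 > y 1 > ⋯ > y p = -2` locate the roots of `T`; if none of them
is a trace `ζ + ζ⁻¹` of a root of unity, then `T` is irreducible. -/
theorem irreducible_and_roots_of_alternating {T : ℤ[X]} {p : ℕ} (hp : 0 < p) (hT : T.Monic)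
    (hdeg : T.natDegree = p) (y : ℕ → ℝ) (hy0 : y 0 = 2.08) (hy1 : y 1 ≤ 2) (hyp : y p = -2)
    (hy : ∀ i < p, y (i + 1) < y i)
    (hsgn : ∀ i ≤ p, 0 < (-1) ^ i * aeval (y i) T)
    (hcyc : ∀ (ζ : ℂ) (n : ℕ), 0 < n → ζ ^ n = 1 → aeval (ζ + ζ⁻¹) T ≠ 0) :
    Irreducible T ∧ ∀ z : ℂ, aeval z T = 0 →
      ∃ r : ℝ, r ∈ Set.Ioo (-2.08 : ℝ) 2.08 ∧ z = (r : ℂ) := by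
  obtain ⟨r, hr, hprod⟩ := exists_roots_of_alternating (hT.map (Int.castRingHom ℝ))
    (by rw [natDegree_map_eq_of_injective (RingHom.injective_int _), hdeg]) y hy fun i hi => by
      rw [eval_map, ← algebraMap_int_eq, ← aeval_def]; exact hsgn i hi
  have hle : ∀ i j, i ≤ j → j ≤ p → y j ≤ y i := by
    intro i j hij
    induction j, hij using Nat.le_induction with
    | base => exact fun _ => le_rfl
    | succ j hij ih => exact fun hj => (hy j hj).le.trans (ih (by omega))
  have hlow : ∀ i < p, -2 < r i := fun i hi =>
    (hyp ▸ hle (i + 1) p hi le_rfl).trans_lt (hr i hi).1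
  have hhigh : ∀ i, 1 ≤ i → i < p → r i < y 1 := fun i h1 hi =>
    (hr i hi).2.trans_le (hle 1 i h1 hi.le)
  refine ⟨irreducible_of_no_rootOfUnity_trace_root hT hp hprod (fun i h1 hi => ?_)
    (fun i h1 hi => ?_) hcyc, fun z hz => ?_⟩
  · exact abs_le.2 ⟨(hlow i hi).le, (hhigh i h1 hi).le.trans hy1⟩
  · exact ((hhigh i h1 hi).trans (hr 0 hp).1).ne
  · obtain ⟨i, hi, h⟩ := exists_eq_of_aeval_eq_zero hprod hz
    refine ⟨r i, ⟨?_, ?_⟩, h⟩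
    · linarith [hlow i hi]
    · exact hy0 ▸ (hr i hi).2.trans_le (hle 0 i (by omega) hi.le)

/-! ### Roots of unity satisfying ζ^m q(ζ) = ±q*(ζ) -/

open Polynomial in
theorem IsPrimitiveRoot.aeval_pow_eq_zero_of_coprime {ζ : ℂ} {n k : ℕ} (h : IsPrimitiveRoot ζ n)
    (hn : 0 < n) (hk : k.Coprime n) {P : ℤ[X]} (h0 : aeval ζ P = 0) : aeval (ζ ^ k) P = 0 := by
  have h1 : minpoly ℤ ζ ∣ P := minpoly.isIntegrallyClosed_dvd (h.isIntegral hn) h0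
  rw [h.minpoly_eq_pow_coprime hk] at h1
  exact aeval_eq_zero_of_dvd_aeval_eq_zero h1 (minpoly.aeval ℤ _)

open Polynomial in
/-- Every root of unity `ζ` is conjugate over `ℚ` to one of `-ζ`, `ζ ^ 2`, `-ζ ^ 2`. -/
theorem rootOfUnity_conjugate {ζ : ℂ} {n : ℕ} (hn : 0 < n) (hζ : ζ ^ n = 1) :
    (∀ P : ℤ[X], aeval ζ P = 0 → aeval (-ζ) P = 0) ∨
    (∀ P : ℤ[X], aeval ζ P = 0 → aeval (ζ ^ 2) P = 0) ∨
    (∀ P : ℤ[X], aeval ζ P = 0 → aeval (-ζ ^ 2) P = 0) := by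
  have hprim := IsPrimitiveRoot.orderOf ζ
  have hpos : 0 < orderOf ζ := orderOf_pos_iff.2 (isOfFinOrder_iff_pow_eq_one.2 ⟨n, hn, hζ⟩)
  have hneg : ∀ k, orderOf ζ = 2 * k → ζ ^ k = -1 := by
    intro k hk
    have h1 : (ζ ^ k) ^ 2 = 1 := by rw [← pow_mul, mul_comm, ← hk, pow_orderOf_eq_one]
    rcases mul_self_eq_one_iff.1 (sq (ζ ^ k) ▸ h1) with h | h
    · have := Nat.le_of_dvd (by omega) (orderOf_dvd_of_pow_eq_one h)
      omega
    · exact h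
  rcases Nat.even_or_odd' (orderOf ζ) with ⟨k, hk | hk⟩
  · have hzk := hneg k hk
    rcases Nat.even_or_odd' k with ⟨j, hj | hj⟩
    · left
      intro P hP
      -- The order is 2k with ζ^k = -1, so the exponent k + 1 yields -ζ; for odd k, k + 2 is the one
      -- prime to 2k and yields -ζ².
      have hc : (k + 1).Coprime (orderOf ζ) := by
        rw [hk, Nat.coprime_mul_iff_right]
        refine ⟨?_, by simp⟩
        rw [Nat.coprime_two_right, hj]
        exact ⟨j, rfl⟩
      have := hprim.aeval_pow_eq_zero_of_coprime hpos hc hP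
      rwa [pow_succ, hzk, neg_one_mul] at this
    · right; right
      intro P hP
      have hk2 : (k + 2).Coprime 2 := by
        rw [Nat.coprime_two_right, hj]
        exact ⟨j + 1, by ring⟩
      have hc : (k + 2).Coprime (orderOf ζ) := by
        rw [hk, Nat.coprime_mul_iff_right]
        refine ⟨hk2, ?_⟩
        rw [Nat.coprime_two_right] at hk2
        simp only [Nat.coprime_self_add_left]
        rw [Nat.coprime_two_left, hj]
        exact ⟨j, rfl⟩
      have := hprim.aeval_pow_eq_zero_of_coprime hpos hc hP
      rwa [pow_add, hzk, neg_one_mul] at this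
  · right; left
    intro P hP
    refine hprim.aeval_pow_eq_zero_of_coprime hpos ?_ hP
    rw [Nat.coprime_two_left, hk]
    exact ⟨k, rfl⟩

theorem mod_eq_of_pow_mul_eq {ζ c : ℂ} {d m a : ℕ} (hd : orderOf ζ = d) (ha : a < d) (hc : c ≠ 0)
    (h : ζ ^ m * c = ζ ^ a * c) : m % d = a := by
  have hprim := IsPrimitiveRoot.orderOf ζ
  rw [hd] at hprim
  have h1 := mul_right_cancel₀ hc h
  rw [← pow_mod_orderOf, hd] at h1
  exact hprim.pow_inj (Nat.mod_lt _ (by omega)) ha h1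

/-- For this and the next orders d: Φ_d divides x^d - 1 and, for each prime p dividing d, also
Φ_p(x^(d/p)). So ζ^(d/p) = 1 would give p = Φ_p(1) = 0. -/
theorem orderOf_eq_3_of_cyclotomic {ζ : ℂ} (h : ζ ^ 2 + ζ + 1 = 0) :
    orderOf ζ = 3 := by
  refine orderOf_eq_of_pow_and_pow_div_prime (by norm_num) ?_ fun p hp hpd => ?_
  · linear_combination (ζ - 1) * h
  · have h1 : p = 3 := by
      have h2 := Nat.le_of_dvd (by norm_num) hpd
      interval_cases p <;> revert hp hpd <;> norm_num
    rcases h1 with rfl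
    · intro h1
      norm_num at h1
      have h2 : 1 + (ζ ^ 1) + (ζ ^ 1) ^ 2 = 0 := by
        linear_combination (1) * h
      norm_num [h1] at h2

theorem orderOf_eq_5_of_cyclotomic {ζ : ℂ} (h : ζ ^ 4 + ζ ^ 3 + ζ ^ 2 + ζ + 1 = 0) :
    orderOf ζ = 5 := by
  refine orderOf_eq_of_pow_and_pow_div_prime (by norm_num) ?_ fun p hp hpd => ?_
  · linear_combination (ζ - 1) * h
  · have h1 : p = 5 := by
      have h2 := Nat.le_of_dvd (by norm_num) hpd
      interval_cases p <;> revert hp hpd <;> norm_num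
    rcases h1 with rfl
    · intro h1
      norm_num at h1
      have h2 : 1 + (ζ ^ 1) + (ζ ^ 1) ^ 2 + (ζ ^ 1) ^ 3 + (ζ ^ 1) ^ 4 = 0 := by
        linear_combination (1) * h
      norm_num [h1] at h2

theorem orderOf_eq_8_of_cyclotomic {ζ : ℂ} (h : ζ ^ 4 + 1 = 0) :
    orderOf ζ = 8 := by
  refine orderOf_eq_of_pow_and_pow_div_prime (by norm_num) ?_ fun p hp hpd => ?_
  · linear_combination (ζ ^ 4 - 1) * h
  · have h1 : p = 2 := by
      have h2 := Nat.le_of_dvd (by norm_num) hpd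
      interval_cases p <;> revert hp hpd <;> norm_num
    rcases h1 with rfl
    · intro h1
      norm_num at h1
      have h2 : 1 + (ζ ^ 4) = 0 := by
        linear_combination (1) * h
      norm_num [h1] at h2

theorem orderOf_eq_12_of_cyclotomic {ζ : ℂ} (h : ζ ^ 4 - ζ ^ 2 + 1 = 0) :
    orderOf ζ = 12 := by
  refine orderOf_eq_of_pow_and_pow_div_prime (by norm_num) ?_ fun p hp hpd => ?_
  · linear_combination (ζ ^ 8 + ζ ^ 6 - ζ ^ 2 - 1) * h
  · have h1 : p = 2 ∨ p = 3 := by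
      have h2 := Nat.le_of_dvd (by norm_num) hpd
      interval_cases p <;> revert hp hpd <;> norm_num
    rcases h1 with rfl | rfl
    · intro h1
      norm_num at h1
      have h2 : 1 + (ζ ^ 6) = 0 := by
        linear_combination (ζ ^ 2 + 1) * h
      norm_num [h1] at h2
    · intro h1
      norm_num at h1
      have h2 : 1 + (ζ ^ 4) + (ζ ^ 4) ^ 2 = 0 := by
        linear_combination (ζ ^ 4 + ζ ^ 2 + 1) * h
      norm_num [h1] at h2

theorem orderOf_eq_18_of_cyclotomic {ζ : ℂ} (h : ζ ^ 6 - ζ ^ 3 + 1 = 0) :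
    orderOf ζ = 18 := by
  refine orderOf_eq_of_pow_and_pow_div_prime (by norm_num) ?_ fun p hp hpd => ?_
  · linear_combination (ζ ^ 12 + ζ ^ 9 - ζ ^ 3 - 1) * h
  · have h1 : p = 2 ∨ p = 3 := by
      have h2 := Nat.le_of_dvd (by norm_num) hpd
      interval_cases p <;> revert hp hpd <;> norm_num
    rcases h1 with rfl | rfl
    · intro h1
      norm_num at h1
      have h2 : 1 + (ζ ^ 9) = 0 := by
        linear_combination (ζ ^ 3 + 1) * h
      norm_num [h1] at h2
    · intro h1
      norm_num at h1
      have h2 : 1 + (ζ ^ 6) + (ζ ^ 6) ^ 2 = 0 := by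
        linear_combination (ζ ^ 6 + ζ ^ 3 + 1) * h
      norm_num [h1] at h2

theorem orderOf_eq_30_of_cyclotomic {ζ : ℂ} (h : ζ ^ 8 + ζ ^ 7 - ζ ^ 5 - ζ ^ 4 - ζ ^ 3 + ζ + 1 = 0) :
    orderOf ζ = 30 := by
  refine orderOf_eq_of_pow_and_pow_div_prime (by norm_num) ?_ fun p hp hpd => ?_
  · linear_combination (ζ ^ 22 - ζ ^ 21 + ζ ^ 20 + ζ ^ 17 - ζ ^ 16 + ζ ^ 15 - ζ ^ 7 + ζ ^ 6 - ζ ^ 5 - ζ ^ 2 + ζ - 1) * h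
  · have h1 : p = 2 ∨ p = 3 ∨ p = 5 := by
      have h2 := Nat.le_of_dvd (by norm_num) hpd
      interval_cases p <;> revert hp hpd <;> norm_num
    rcases h1 with rfl | rfl | rfl
    · intro h1
      norm_num at h1
      have h2 : 1 + (ζ ^ 15) = 0 := by
        linear_combination (ζ ^ 7 - ζ ^ 6 + ζ ^ 5 + ζ ^ 2 - ζ + 1) * h
      norm_num [h1] at h2
    · intro h1
      norm_num at h1
      have h2 : 1 + (ζ ^ 10) + (ζ ^ 10) ^ 2 = 0 := by
        linear_combination (ζ ^ 12 - ζ ^ 11 + ζ ^ 10 + ζ ^ 7 - ζ ^ 6 + ζ ^ 5 + ζ ^ 2 - ζ + 1) * h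
      norm_num [h1] at h2
    · intro h1
      norm_num at h1
      have h2 : 1 + (ζ ^ 6) + (ζ ^ 6) ^ 2 + (ζ ^ 6) ^ 3 + (ζ ^ 6) ^ 4 = 0 := by
        linear_combination (ζ ^ 16 - ζ ^ 15 + ζ ^ 14 + ζ ^ 11 + ζ ^ 8 + ζ ^ 5 + ζ ^ 2 - ζ + 1) * h
      norm_num [h1] at h2

/-- The polynomials q and q* are coprime: (t - 1)q* - tq = 1. -/
theorem plastic_ne_zero_of_pow_mul_eq {ζ : ℂ} {m : ℕ} {ε : ℂ} (hε : ε ≠ 0)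
    (h0 : ζ ^ m * (ζ ^ 3 - ζ - 1) = ε * (ζ ^ 3 + ζ ^ 2 - 1)) : ζ ^ 3 - ζ - 1 ≠ 0 := by
  intro hq
  have h1 : ζ ^ 3 + ζ ^ 2 - 1 = 0 := by
    rw [hq, mul_zero] at h0
    exact (mul_eq_zero.1 h0.symm).resolve_left hε
  have h2 : (1 : ℂ) = 0 := by
    linear_combination (-ζ) * hq + (ζ - 1) * h1
  exact one_ne_zero h2

open Polynomial in
theorem pow_mul_plastic_conjugate {ζ η : ℂ} (h : ∀ P : ℤ[X], aeval ζ P = 0 → aeval η P = 0)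
    {m : ℕ} {ε : ℤ} (h0 : ζ ^ m * (ζ ^ 3 - ζ - 1) = ε * (ζ ^ 3 + ζ ^ 2 - 1)) :
    η ^ m * (η ^ 3 - η - 1) = ε * (η ^ 3 + η ^ 2 - 1) := by
  have := h (X ^ m * (X ^ 3 - X - 1) - C ε * (X ^ 3 + X ^ 2 - 1)) (by simp [h0])
  simpa [sub_eq_zero] using this

/-- Each conjugation type gives a second equation for ζ^m, and elimination leaves a product of
cyclotomic factors. The residue of m is the exponent a for which Φ_d divides t^a q + q*. The orders
5, 8, 18 are the Coxeter numbers of E₄ = A₄, E₅ = D₅ and E₇, with a two less than the index. -/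
theorem rootOfUnity_cases_odd_neg {ζ : ℂ} {n m : ℕ} (hn : 0 < n) (hζ : ζ ^ n = 1) (hm : Odd m)
    (h0 : ζ ^ m * (ζ ^ 3 - ζ - 1) = -(ζ ^ 3 + ζ ^ 2 - 1)) :
    ζ ^ 2 = 1 ∨
    (ζ ^ 2 + ζ + 1 = 0 ∧ m % 3 = 1) ∨
    (ζ ^ 4 + ζ ^ 3 + ζ ^ 2 + ζ + 1 = 0 ∧ m % 5 = 2) ∨
    (ζ ^ 4 + 1 = 0 ∧ m % 8 = 3) ∨
    (ζ ^ 6 - ζ ^ 3 + 1 = 0 ∧ m % 18 = 5) := by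
  have hζ0 : ζ ≠ 0 := by rintro rfl; simp [hn.ne'] at hζ
  have h0' : ζ ^ m * (ζ ^ 3 - ζ - 1) = (-1 : ℤ) * (ζ ^ 3 + ζ ^ 2 - 1) := by
    push_cast; linear_combination h0
  have hq := plastic_ne_zero_of_pow_mul_eq (by norm_num) h0'
  have hw : ζ ^ m ≠ 0 := pow_ne_zero _ hζ0
  have c3 : ζ ^ 2 + ζ + 1 = 0 → m % 3 = 1 := by
    intro h
    exact mod_eq_of_pow_mul_eq (orderOf_eq_3_of_cyclotomic h) (by norm_num) hq
      (by linear_combination h0 - (ζ ^ 2 - 1) * h)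
  have c5 : ζ ^ 4 + ζ ^ 3 + ζ ^ 2 + ζ + 1 = 0 → m % 5 = 2 := by
    intro h
    exact mod_eq_of_pow_mul_eq (orderOf_eq_5_of_cyclotomic h) (by norm_num) hq
      (by linear_combination h0 - (ζ - 1) * h)
  have c8 : ζ ^ 4 + 1 = 0 → m % 8 = 3 := by
    intro h
    exact mod_eq_of_pow_mul_eq (orderOf_eq_8_of_cyclotomic h) (by norm_num) hq
      (by linear_combination h0 - (ζ ^ 2 - 1) * h)
  have c18 : ζ ^ 6 - ζ ^ 3 + 1 = 0 → m % 18 = 5 := by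
    intro h
    exact mod_eq_of_pow_mul_eq (orderOf_eq_18_of_cyclotomic h) (by norm_num) hq
      (by linear_combination h0 - (ζ ^ 2 - 1) * h)
  rcases rootOfUnity_conjugate hn hζ with hc | hc | hc
  all_goals have h1 := pow_mul_plastic_conjugate hc h0'
  all_goals push_cast at h1
  · rw [hm.neg_pow] at h1
    have h2 : ζ ^ m * (2 * ((ζ ^ 2 - 1) * (ζ ^ 4 + 1))) = 0 := by
      linear_combination -(((-ζ) ^ 3 + (-ζ) ^ 2 - 1) * h0 - (ζ ^ 3 + ζ ^ 2 - 1) * h1)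
    simp only [mul_eq_zero, hw, OfNat.ofNat_ne_zero, false_or] at h2
    rcases h2 with h2 | h2
    · exact Or.inl (sub_eq_zero.1 h2)
    · exact Or.inr (Or.inr (Or.inr (Or.inl ⟨h2, c8 h2⟩)))
  · rw [← pow_mul, mul_comm 2 m, pow_mul] at h1
    -- The conjugate equation involves (ζ^m)², so it is compared with the square of `h0`.
    have h2 : (ζ ^ m) ^ 2 * (2 * ((ζ ^ 2 - 1) * (ζ - 1) ^ 2 * (ζ ^ 2 + ζ + 1) ^ 2 *
        (ζ ^ 4 + ζ ^ 3 + ζ ^ 2 + ζ + 1))) = 0 := by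
      linear_combination (ζ ^ 3 + ζ ^ 2 - 1) ^ 2 * h1 +
        ((ζ ^ 2) ^ 3 + (ζ ^ 2) ^ 2 - 1) * (ζ ^ m * (ζ ^ 3 - ζ - 1) - (ζ ^ 3 + ζ ^ 2 - 1)) * h0
    simp only [mul_eq_zero, hw, OfNat.ofNat_ne_zero, false_or, pow_eq_zero_iff, ne_eq,
      not_false_eq_true] at h2
    rcases h2 with ((h2 | h2) | h2) | h2
    · exact Or.inl (sub_eq_zero.1 h2)
    · exact Or.inl (by rw [sub_eq_zero.1 h2]; norm_num)
    · exact Or.inr (Or.inl ⟨h2, c3 h2⟩)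
    · exact Or.inr (Or.inr (Or.inl ⟨h2, c5 h2⟩))
  · rw [hm.neg_pow, ← pow_mul, mul_comm 2 m, pow_mul] at h1
    have h2 : (ζ ^ m) ^ 2 * (2 * (ζ * ((ζ ^ 2 - 1) * (ζ + 1) ^ 2 *
        (ζ ^ 6 - ζ ^ 3 + 1)))) = 0 := by
      linear_combination (ζ ^ 3 + ζ ^ 2 - 1) ^ 2 * h1 +
        ((-ζ ^ 2) ^ 3 + (-ζ ^ 2) ^ 2 - 1) * (ζ ^ m * (ζ ^ 3 - ζ - 1) - (ζ ^ 3 + ζ ^ 2 - 1)) * h0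
    simp only [mul_eq_zero, hw, hζ0, OfNat.ofNat_ne_zero, false_or, pow_eq_zero_iff, ne_eq,
      not_false_eq_true] at h2
    rcases h2 with (h2 | h2) | h2
    · exact Or.inl (sub_eq_zero.1 h2)
    · exact Or.inl (by rw [eq_neg_of_add_eq_zero_left h2]; norm_num)
    · exact Or.inr (Or.inr (Or.inr (Or.inr ⟨h2, c18 h2⟩)))

theorem rootOfUnity_cases_even_neg {ζ : ℂ} {n m : ℕ} (hn : 0 < n) (hζ : ζ ^ n = 1) (hm : Even m)
    (h0 : ζ ^ m * (ζ ^ 3 - ζ - 1) = -(ζ ^ 3 + ζ ^ 2 - 1)) :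
    ζ ^ 2 = 1 ∨
    (ζ ^ 2 + ζ + 1 = 0 ∧ m % 3 = 1) ∨
    (ζ ^ 4 + ζ ^ 3 + ζ ^ 2 + ζ + 1 = 0 ∧ m % 5 = 2) ∨
    (ζ ^ 4 - ζ ^ 2 + 1 = 0 ∧ m % 12 = 4) ∨
    (ζ ^ 8 + ζ ^ 7 - ζ ^ 5 - ζ ^ 4 - ζ ^ 3 + ζ + 1 = 0 ∧ m % 30 = 6) := by
  have hζ0 : ζ ≠ 0 := by rintro rfl; simp [hn.ne'] at hζ
  have h0' : ζ ^ m * (ζ ^ 3 - ζ - 1) = (-1 : ℤ) * (ζ ^ 3 + ζ ^ 2 - 1) := by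
    push_cast; linear_combination h0
  have hq := plastic_ne_zero_of_pow_mul_eq (by norm_num) h0'
  have hw : ζ ^ m ≠ 0 := pow_ne_zero _ hζ0
  have c3 : ζ ^ 2 + ζ + 1 = 0 → m % 3 = 1 := by
    intro h
    exact mod_eq_of_pow_mul_eq (orderOf_eq_3_of_cyclotomic h) (by norm_num) hq
      (by linear_combination h0 - (ζ ^ 2 - 1) * h)
  have c5 : ζ ^ 4 + ζ ^ 3 + ζ ^ 2 + ζ + 1 = 0 → m % 5 = 2 := by
    intro h
    exact mod_eq_of_pow_mul_eq (orderOf_eq_5_of_cyclotomic h) (by norm_num) hq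
      (by linear_combination h0 - (ζ - 1) * h)
  have c12 : ζ ^ 4 - ζ ^ 2 + 1 = 0 → m % 12 = 4 := by
    intro h
    exact mod_eq_of_pow_mul_eq (orderOf_eq_12_of_cyclotomic h) (by norm_num) hq
      (by linear_combination h0 - (ζ ^ 3 - 1) * h)
  have c30 : ζ ^ 8 + ζ ^ 7 - ζ ^ 5 - ζ ^ 4 - ζ ^ 3 + ζ + 1 = 0 → m % 30 = 6 := by
    intro h
    exact mod_eq_of_pow_mul_eq (orderOf_eq_30_of_cyclotomic h) (by norm_num) hq
      (by linear_combination h0 - (ζ - 1) * h)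
  rcases rootOfUnity_conjugate hn hζ with hc | hc | hc
  all_goals have h1 := pow_mul_plastic_conjugate hc h0'
  all_goals push_cast at h1
  · rw [hm.neg_pow] at h1
    have h2 : ζ ^ m * (2 * (ζ * (ζ ^ 4 - ζ ^ 2 + 1))) = 0 := by
      linear_combination -((ζ ^ 3 + ζ ^ 2 - 1) * h1 - ((-ζ) ^ 3 + (-ζ) ^ 2 - 1) * h0)
    simp only [mul_eq_zero, hw, hζ0, OfNat.ofNat_ne_zero, false_or] at h2
    exact Or.inr (Or.inr (Or.inr (Or.inl ⟨h2, c12 h2⟩)))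
  · rw [← pow_mul, mul_comm 2 m, pow_mul] at h1
    have h2 : (ζ ^ m) ^ 2 * (2 * ((ζ ^ 2 - 1) * (ζ - 1) ^ 2 * (ζ ^ 2 + ζ + 1) ^ 2 *
        (ζ ^ 4 + ζ ^ 3 + ζ ^ 2 + ζ + 1))) = 0 := by
      linear_combination (ζ ^ 3 + ζ ^ 2 - 1) ^ 2 * h1 +
        ((ζ ^ 2) ^ 3 + (ζ ^ 2) ^ 2 - 1) * (ζ ^ m * (ζ ^ 3 - ζ - 1) - (ζ ^ 3 + ζ ^ 2 - 1)) * h0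
    simp only [mul_eq_zero, hw, OfNat.ofNat_ne_zero, false_or, pow_eq_zero_iff, ne_eq,
      not_false_eq_true] at h2
    rcases h2 with ((h2 | h2) | h2) | h2
    · exact Or.inl (sub_eq_zero.1 h2)
    · exact Or.inl (by rw [sub_eq_zero.1 h2]; norm_num)
    · exact Or.inr (Or.inl ⟨h2, c3 h2⟩)
    · exact Or.inr (Or.inr (Or.inl ⟨h2, c5 h2⟩))
  · rw [hm.neg_pow, ← pow_mul, mul_comm 2 m, pow_mul] at h1
    have h2 : (ζ ^ m) ^ 2 * (2 * ((ζ ^ 4 - ζ ^ 2 + 1) *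
        (ζ ^ 8 + ζ ^ 7 - ζ ^ 5 - ζ ^ 4 - ζ ^ 3 + ζ + 1))) = 0 := by
      linear_combination -((ζ ^ 3 + ζ ^ 2 - 1) ^ 2 * h1 +
        ((-ζ ^ 2) ^ 3 + (-ζ ^ 2) ^ 2 - 1) * (ζ ^ m * (ζ ^ 3 - ζ - 1) - (ζ ^ 3 + ζ ^ 2 - 1)) * h0)
    simp only [mul_eq_zero, hw, OfNat.ofNat_ne_zero, false_or, pow_eq_zero_iff, ne_eq,
      not_false_eq_true] at h2
    rcases h2 with h2 | h2
    · exact Or.inr (Or.inr (Or.inr (Or.inl ⟨h2, c12 h2⟩)))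
    · exact Or.inr (Or.inr (Or.inr (Or.inr ⟨h2, c30 h2⟩)))

open Polynomial in
/-- Lehmer's polynomial has no root that is conjugate to its square. -/
theorem lehmer_ne_zero_of_conjugate_sq {ζ : ℂ} (hζ : ζ ≠ 0)
    (hc : ∀ P : ℤ[X], aeval ζ P = 0 → aeval (ζ ^ 2) P = 0) :
    ζ ^ 10 + ζ ^ 9 - ζ ^ 7 - ζ ^ 6 - ζ ^ 5 - ζ ^ 4 - ζ ^ 3 + ζ + 1 ≠ 0 := by
  intro h
  have h2 := hc (X ^ 10 + X ^ 9 - X ^ 7 - X ^ 6 - X ^ 5 - X ^ 4 - X ^ 3 + X + 1) (by simpa using h)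
  simp only [map_add, map_sub, map_pow, aeval_X, map_one] at h2
  -- In y = ζ + 1/ζ Lehmer's polynomial becomes a quintic, and squaring ζ becomes y ↦ y² - 2.
  obtain ⟨y, hy⟩ : ∃ y, y = ζ + ζ⁻¹ := ⟨_, rfl⟩
  have hy1 : ζ ^ 5 * (y ^ 5 + y ^ 4 - 5 * y ^ 3 - 5 * y ^ 2 + 4 * y + 3) = 0 := by
    rw [hy]; field_simp; linear_combination h
  have hz : y ^ 2 - 2 = ζ ^ 2 + (ζ ^ 2)⁻¹ := by
    rw [hy]; field_simp; ring
  obtain ⟨z, hz'⟩ : ∃ z, z = y ^ 2 - 2 := ⟨_, rfl⟩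
  have hy2 : (ζ ^ 2) ^ 5 * (z ^ 5 + z ^ 4 - 5 * z ^ 3 - 5 * z ^ 2 + 4 * z + 3) = 0 := by
    rw [hz', hz]; field_simp; linear_combination h2
  have e1 := (mul_eq_zero.1 hy1).resolve_left (pow_ne_zero _ hζ)
  have e2 := (mul_eq_zero.1 hy2).resolve_left (pow_ne_zero _ (pow_ne_zero _ hζ))
  rw [hz'] at e2
  have : (1 : ℂ) = 0 := by
    -- Bézout cofactors for the quintic at y and at y² - 2.
    linear_combination (-1/2 * y ^ 9 + 9/2 * y ^ 7 - 1/2 * y ^ 6 - 13 * y ^ 5 + 3 * y ^ 4 + 25/2 * y ^ 3 - 9/2 * y ^ 2 - 2 * y + 1) * e1 +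
      (1/2 * y ^ 4 + 1/2 * y ^ 3 - 5/2 * y ^ 2 - 2 * y + 2) * e2
  exact one_ne_zero this

/-- With the plus sign, the conjugate ζ² leads to Lehmer's polynomial instead of cyclotomic factors,
so that case is void. -/
theorem rootOfUnity_cases_even_pos {ζ : ℂ} {n m : ℕ} (hn : 0 < n) (hζ : ζ ^ n = 1) (hm : Even m)
    (h0 : ζ ^ m * (ζ ^ 3 - ζ - 1) = (ζ ^ 3 + ζ ^ 2 - 1)) :
    ζ ^ 2 = 1 ∨
    (ζ ^ 4 - ζ ^ 2 + 1 = 0 ∧ m % 12 = 10) ∨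
    (ζ ^ 6 - ζ ^ 3 + 1 = 0 ∧ m % 18 = 14) := by
  have hζ0 : ζ ≠ 0 := by rintro rfl; simp [hn.ne'] at hζ
  have h0' : ζ ^ m * (ζ ^ 3 - ζ - 1) = (1 : ℤ) * (ζ ^ 3 + ζ ^ 2 - 1) := by
    push_cast; linear_combination h0
  have hq := plastic_ne_zero_of_pow_mul_eq (by norm_num) h0'
  have hw : ζ ^ m ≠ 0 := pow_ne_zero _ hζ0
  have c12 : ζ ^ 4 - ζ ^ 2 + 1 = 0 → m % 12 = 10 := by
    intro h
    exact mod_eq_of_pow_mul_eq (orderOf_eq_12_of_cyclotomic h) (by norm_num) hq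
      (by linear_combination h0 - (ζ ^ 9 - ζ ^ 6 - ζ ^ 5 - ζ ^ 4 - ζ ^ 3 + 1) * h)
  have c18 : ζ ^ 6 - ζ ^ 3 + 1 = 0 → m % 18 = 14 := by
    intro h
    exact mod_eq_of_pow_mul_eq (orderOf_eq_18_of_cyclotomic h) (by norm_num) hq
      (by linear_combination h0 - (ζ ^ 11 - ζ ^ 9 - ζ ^ 6 - ζ ^ 5 - ζ ^ 2 + 1) * h)
  rcases rootOfUnity_conjugate hn hζ with hc | hc | hc
  all_goals have h1 := pow_mul_plastic_conjugate hc h0'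
  all_goals push_cast at h1
  · rw [hm.neg_pow] at h1
    have h2 : ζ ^ m * (2 * (ζ * (ζ ^ 4 - ζ ^ 2 + 1))) = 0 := by
      linear_combination -((ζ ^ 3 + ζ ^ 2 - 1) * h1 - ((-ζ) ^ 3 + (-ζ) ^ 2 - 1) * h0)
    simp only [mul_eq_zero, hw, hζ0, OfNat.ofNat_ne_zero, false_or] at h2
    exact Or.inr (Or.inl ⟨h2, c12 h2⟩)
  · rw [← pow_mul, mul_comm 2 m, pow_mul] at h1
    have h2 : (ζ ^ m) ^ 2 * (2 * (ζ * (ζ ^ 10 + ζ ^ 9 - ζ ^ 7 - ζ ^ 6 - ζ ^ 5 - ζ ^ 4 - ζ ^ 3 + ζ + 1))) = 0 := by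
      linear_combination (ζ ^ 3 + ζ ^ 2 - 1) ^ 2 * h1 -
        ((ζ ^ 2) ^ 3 + (ζ ^ 2) ^ 2 - 1) * (ζ ^ m * (ζ ^ 3 - ζ - 1) + (ζ ^ 3 + ζ ^ 2 - 1)) * h0
    simp only [mul_eq_zero, hw, hζ0, OfNat.ofNat_ne_zero, false_or, pow_eq_zero_iff, ne_eq,
      not_false_eq_true] at h2
    exact absurd h2 (lehmer_ne_zero_of_conjugate_sq hζ0 hc)
  · rw [hm.neg_pow, ← pow_mul, mul_comm 2 m, pow_mul] at h1
    have h2 : (ζ ^ m) ^ 2 * (2 * (ζ * ((ζ ^ 2 - 1) * (ζ + 1) ^ 2 *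
        (ζ ^ 6 - ζ ^ 3 + 1)))) = 0 := by
      linear_combination -((ζ ^ 3 + ζ ^ 2 - 1) ^ 2 * h1 -
        ((-ζ ^ 2) ^ 3 + (-ζ ^ 2) ^ 2 - 1) * (ζ ^ m * (ζ ^ 3 - ζ - 1) + (ζ ^ 3 + ζ ^ 2 - 1)) * h0)
    simp only [mul_eq_zero, hw, hζ0, OfNat.ofNat_ne_zero, false_or, pow_eq_zero_iff, ne_eq,
      not_false_eq_true] at h2
    rcases h2 with (h2 | h2) | h2
    · exact Or.inl (sub_eq_zero.1 h2)
    · exact Or.inl (by rw [eq_neg_of_add_eq_zero_left h2]; norm_num)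
    · exact Or.inr (Or.inr ⟨h2, c18 h2⟩)

/-! ### Chebyshev polynomials: degrees, special values, growth at 2.08 -/

namespace Polynomial.Chebyshev

theorem degree_S_natCast (n : ℕ) : (S ℤ n).degree = n := by
  induction n using Nat.twoStepInduction with
  | zero => simp
  | one => simp
  | more n ih0 ih1 =>
    push_cast at *
    rw [S_add_two, degree_sub_eq_left_of_degree_lt] <;> rw [degree_mul, degree_X, ih1]
    · norm_cast; ring
    · rw [ih0]; norm_cast; omega

theorem monic_S_natCast (n : ℕ) : (S ℤ n).Monic := by
  induction n using Nat.twoStepInduction with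
  | zero => simp
  | one => simp [monic_X]
  | more n ih0 ih1 =>
    have h0 := degree_S_natCast n
    have h1 := degree_S_natCast (n + 1)
    push_cast at *
    rw [S_add_two]
    refine (monic_X.mul ih1).sub_of_left ?_
    rw [degree_mul, degree_X, h0, h1]
    norm_cast; omega

theorem degree_S_natCast_lt {m n : ℕ} (h : m < n) : (S ℤ m).degree < (S ℤ n).degree := by
  rw [degree_S_natCast, degree_S_natCast]; exact_mod_cast h

theorem natDegree_S_natCast (n : ℕ) : (S ℤ n).natDegree = n :=
  natDegree_eq_of_degree_eq_some (degree_S_natCast n)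

theorem eval_zero_S_two_mul (n : ℕ) :
    (S ℤ ((2 * n : ℕ) : ℤ)).eval 0 = (-1) ^ n ∧ (S ℤ ((2 * n + 1 : ℕ) : ℤ)).eval 0 = 0 := by
  induction n with
  | zero => simp
  | succ n ih =>
    have h0 := S_add_two ℤ (2 * n)
    have h1 := S_add_two ℤ (2 * n + 1)
    push_cast at ih ⊢
    rw [show (2 * ((n : ℤ) + 1)) = 2 * n + 2 by ring, h0,
      show (2 * (n : ℤ) + 2 + 1) = 2 * n + 1 + 2 by ring, h1]
    simp [ih.1, ih.2, pow_succ]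

theorem pow_mul_eval_S {t : ℂ} (ht : t ≠ 0) (n : ℕ) :
    t ^ n * (t ^ 2 - 1) * (S ℂ n).eval (t + t⁻¹) = t ^ (2 * n + 2) - 1 := by
  induction n using Nat.twoStepInduction with
  | zero => simp
  | one => simp; field_simp; ring
  | more n ih0 ih1 =>
    push_cast at *
    rw [S_add_two, eval_sub, eval_mul, eval_X]
    have h1 : t * (t + t⁻¹) = t ^ 2 + 1 := by field_simp
    linear_combination t ^ (n + 1) * (t ^ 2 - 1) * (S ℂ (n + 1)).eval (t + t⁻¹) * h1
      + (t ^ 2 + 1) * ih1 - t ^ 2 * ih0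

/-- Values at the zeros of `S (n + 1)`. -/
theorem eval_S_zeros (n j : ℕ) (hj : 1 ≤ j) (hjn : j ≤ n + 1) :
    (S ℝ (n + 1)).eval (2 * Real.cos (j * Real.pi / (n + 2))) = 0 ∧
    (S ℝ n).eval (2 * Real.cos (j * Real.pi / (n + 2))) = (-1) ^ (j + 1) := by
  set θ := j * Real.pi / (n + 2) with hθ
  have hn : (0 : ℝ) < n + 2 := by positivity
  have hj' : (1 : ℝ) ≤ j := by exact_mod_cast hj
  have hjn' : (j : ℝ) ≤ n + 1 := by exact_mod_cast hjn
  have hmul : (n + 2) * θ = j * Real.pi := by rw [hθ]; field_simp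
  have hsin : Real.sin θ ≠ 0 := by
    apply ne_of_gt
    apply Real.sin_pos_of_pos_of_lt_pi
    · rw [hθ]; positivity
    · rw [hθ, div_lt_iff₀ hn, mul_comm]
      exact mul_lt_mul_of_pos_left (by linarith) Real.pi_pos
  constructor
  · apply mul_right_cancel₀ hsin
    rw [S_two_mul_real_cos, zero_mul]
    push_cast
    rw [show ((n : ℝ) + 1 + 1) * θ = j * Real.pi by linarith, Real.sin_nat_mul_pi]
  · apply mul_right_cancel₀ hsin
    rw [S_two_mul_real_cos]
    push_cast
    rw [show ((n : ℝ) + 1) * θ = j * Real.pi - θ by linarith, Real.sin_sub, Real.sin_nat_mul_pi,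
      Real.cos_nat_mul_pi]
    ring

/-- The ratio of consecutive values tends to 1/t ≈ 0.7543, where t + 1/t = 2.08 and t > 1. The bound
0.7545 propagates because 0.7545 · (2.08 - 0.7545) > 1, and lies below 3.08/4.08 and 7.16/3.08², the
thresholds for `coxeterOdd` and `coxeterEven` to be positive at 2.08. -/
theorem eval_S_growth_upper (n : ℕ) :
    0 < (S ℝ (n + 1)).eval 2.08 ∧ (S ℝ n).eval 2.08 < 0.7545 * (S ℝ (n + 1)).eval 2.08 := by
  induction n with
  | zero => norm_num
  | succ n ih =>
    push_cast
    rw [show (n : ℤ) + 1 + 1 = n + 2 by ring, S_add_two, eval_sub, eval_mul, eval_X]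
    constructor <;> linarith

/-- The constant is forced: x² - x - 3 = -0.7536 at x = 2.08, so this is positivity of
`plasticAbove` there. The ratio needs several steps to climb that high. -/
theorem eval_S_growth_lower (n : ℕ) :
    0.7536 * (S ℝ (n + 11)).eval 2.08 < (S ℝ (n + 10)).eval 2.08 := by
  induction n with
  | zero =>
    have h : ∀ k : ℕ, (S ℝ (k + 2)).eval 2.08 =
        2.08 * (S ℝ (k + 1)).eval 2.08 - (S ℝ k).eval 2.08 := fun k => by simp [S_add_two]
    have h0 := h 0
    have h1 := h 1
    have h2 := h 2
    have h3 := h 3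
    have h4 := h 4
    have h5 := h 5
    have h6 := h 6
    have h7 := h 7
    have h8 := h 8
    have h9 := h 9
    norm_num at h0 h1 h2 h3 h4 h5 h6 h7 h8 h9 ⊢
    rw [h0] at h1
    linarith
  | succ n ih =>
    have h := (eval_S_growth_upper (n + 10)).1
    push_cast at h ⊢
    rw [show (n : ℤ) + 1 + 11 = n + 10 + 2 by ring, S_add_two, eval_sub, eval_mul, eval_X,
      show (n : ℤ) + 1 + 10 = n + 10 + 1 by ring]
    rw [show (n : ℤ) + 11 = n + 10 + 1 by ring] at ih
    linarith

end Polynomial.Chebyshev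

/-! ### Three families of trace polynomials -/

open Polynomial Polynomial.Chebyshev

theorem Polynomial.Chebyshev.eval_neg_two_S_natCast {R : Type*} [CommRing R] (n : ℕ) :
    (S R n).eval (-2) = (-1) ^ n * (n + 1) := by
  rw [S_eval_neg_two]; simp

/-- The trace polynomial of the Coxeter polynomial `E_{2n+7}`, divided by `t + 1`. -/
noncomputable def coxeterOdd (n : ℕ) : ℤ[X] := S ℤ (n + 3) - S ℤ (n + 1) - S ℤ n

/-- The trace polynomial of `(t^(2n+6)(t^3-t-1) - (t^3+t^2-1)) / (t + 1)`. -/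
noncomputable def plasticAbove (n : ℕ) : ℤ[X] :=
  S ℤ (n + 4) - S ℤ (n + 3) - S ℤ (n + 2) + S ℤ n

/-- The trace polynomial of the Coxeter polynomial `E_{2n+8}`. -/
noncomputable def coxeterEven (n : ℕ) : ℤ[X] :=
  S ℤ (n + 4) + S ℤ (n + 3) - S ℤ (n + 2) - 2 * S ℤ (n + 1) - S ℤ n

/-- With only two consecutive `S`, a single term survives at the zeros of the higher one. -/
theorem coxeterOdd_eq (n : ℕ) :
    coxeterOdd n = (X + 1) * S ℤ (n + 2) - (X + 2) * S ℤ (n + 1) := by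
  have h1 := S_add_two ℤ (n + 1)
  have h2 := S_add_two ℤ n
  rw [show (n : ℤ) + 1 + 2 = n + 3 by ring, show (n : ℤ) + 1 + 1 = n + 2 by ring] at h1
  rw [coxeterOdd]
  linear_combination h1 - h2

theorem plasticAbove_eq (n : ℕ) :
    plasticAbove n = (X ^ 2 - X - 3) * S ℤ (n + 2) + S ℤ (n + 1) := by
  have h0 := S_add_two ℤ (n + 2)
  have h1 := S_add_two ℤ (n + 1)
  have h2 := S_add_two ℤ n
  rw [show (n : ℤ) + 2 + 2 = n + 4 by ring, show (n : ℤ) + 2 + 1 = n + 3 by ring] at h0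
  rw [show (n : ℤ) + 1 + 2 = n + 3 by ring, show (n : ℤ) + 1 + 1 = n + 2 by ring] at h1
  rw [plasticAbove]
  linear_combination h0 + (X - 1) * h1 + h2

theorem coxeterEven_eq (n : ℕ) :
    coxeterEven n = (2 * X + 3) * S ℤ (n + 3) - (X + 1) ^ 2 * S ℤ (n + 2) := by
  have h0 := S_add_two ℤ (n + 2)
  have h1 := S_add_two ℤ (n + 1)
  have h2 := S_add_two ℤ n
  rw [show (n : ℤ) + 2 + 2 = n + 4 by ring, show (n : ℤ) + 2 + 1 = n + 3 by ring] at h0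
  rw [show (n : ℤ) + 1 + 2 = n + 3 by ring, show (n : ℤ) + 1 + 1 = n + 2 by ring] at h1
  rw [coxeterEven]
  linear_combination h0 - (X + 2) * h1 - h2

theorem Polynomial.degree_add_lt {R : Type*} [Semiring R] {P Q : R[X]} {d : WithBot ℕ}
    (hP : P.degree < d) (hQ : Q.degree < d) : (P + Q).degree < d :=
  (degree_add_le P Q).trans_lt (max_lt hP hQ)

theorem Polynomial.Monic.add_of_degree_lt_S {Q : ℤ[X]} {n : ℕ}
    (hQ : Q.degree < (S ℤ n).degree) : (S ℤ n + Q).Monic ∧ (S ℤ n + Q).natDegree = n :=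
  ⟨(monic_S_natCast n).add_of_left hQ, by
    rw [natDegree_add_eq_left_of_degree_lt hQ, natDegree_S_natCast]⟩

theorem monic_coxeterOdd (n : ℕ) : (coxeterOdd n).Monic ∧ (coxeterOdd n).natDegree = n + 3 := by
  have h1 := degree_S_natCast_lt (show n + 1 < n + 3 by omega)
  have h0 := degree_S_natCast_lt (show n < n + 3 by omega)
  have := Polynomial.Monic.add_of_degree_lt_S (n := n + 3)
    (Q := -S ℤ ((n + 1 : ℕ) : ℤ) + -S ℤ (n : ℤ))
    (Polynomial.degree_add_lt (by rwa [degree_neg]) (by rwa [degree_neg]))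
  push_cast at this
  rwa [show coxeterOdd n =
    S ℤ (n + 3) + (-S ℤ (n + 1) + -S ℤ n) by rw [coxeterOdd]; ring]

theorem monic_plasticAbove (n : ℕ) :
    (plasticAbove n).Monic ∧ (plasticAbove n).natDegree = n + 4 := by
  have h3 := degree_S_natCast_lt (show n + 3 < n + 4 by omega)
  have h2 := degree_S_natCast_lt (show n + 2 < n + 4 by omega)
  have h0 := degree_S_natCast_lt (show n < n + 4 by omega)
  have := Polynomial.Monic.add_of_degree_lt_S (n := n + 4)
    (Q := -S ℤ ((n + 3 : ℕ) : ℤ) + -S ℤ ((n + 2 : ℕ) : ℤ) + S ℤ (n : ℤ))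
    (Polynomial.degree_add_lt (Polynomial.degree_add_lt (by rwa [degree_neg])
      (by rwa [degree_neg])) h0)
  push_cast at this
  rwa [show plasticAbove n =
    S ℤ (n + 4) + (-S ℤ (n + 3) + -S ℤ (n + 2) + S ℤ n) by rw [plasticAbove]; ring]

theorem monic_coxeterEven (n : ℕ) :
    (coxeterEven n).Monic ∧ (coxeterEven n).natDegree = n + 4 := by
  have h3 := degree_S_natCast_lt (show n + 3 < n + 4 by omega)
  have h2 := degree_S_natCast_lt (show n + 2 < n + 4 by omega)
  have h1 := degree_S_natCast_lt (show n + 1 < n + 4 by omega)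
  have h0 := degree_S_natCast_lt (show n < n + 4 by omega)
  have h1' : (-S ℤ ((n + 1 : ℕ) : ℤ)).degree < (S ℤ ((n + 4 : ℕ) : ℤ)).degree := by
    rwa [degree_neg]
  have := Polynomial.Monic.add_of_degree_lt_S (n := n + 4)
    (Q := S ℤ ((n + 3 : ℕ) : ℤ) + -S ℤ ((n + 2 : ℕ) : ℤ) +
      (-S ℤ ((n + 1 : ℕ) : ℤ) + -S ℤ ((n + 1 : ℕ) : ℤ)) + -S ℤ (n : ℤ))
    (Polynomial.degree_add_lt (Polynomial.degree_add_lt (Polynomial.degree_add_lt h3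
      (by rwa [degree_neg])) (Polynomial.degree_add_lt h1' h1')) (by rwa [degree_neg]))
  push_cast at this
  rwa [show coxeterEven n =
    S ℤ (n + 4) + (S ℤ (n + 3) + -S ℤ (n + 2) + (-S ℤ (n + 1) + -S ℤ (n + 1)) + -S ℤ n) by rw [coxeterEven]; ring]

theorem coeff_zero_coxeterOdd {n : ℕ} (hn : Even n) :
    (coxeterOdd n).coeff 0 = 1 ∨ (coxeterOdd n).coeff 0 = -1 := by
  obtain ⟨k, rfl⟩ := hn
  have h0 := (eval_zero_S_two_mul k).1
  have h1 := (eval_zero_S_two_mul k).2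
  have h3 := (eval_zero_S_two_mul (k + 1)).2
  have e0 : ((k + k : ℕ) : ℤ) = (2 * k : ℕ) := by push_cast; ring
  have e1 : ((k + k : ℕ) : ℤ) + 1 = (2 * k + 1 : ℕ) := by push_cast; ring
  have e3 : ((k + k : ℕ) : ℤ) + 3 = (2 * (k + 1) + 1 : ℕ) := by push_cast; ring
  rw [coeff_zero_eq_eval_zero, coxeterOdd, e3, e1, e0, eval_sub, eval_sub, h0, h1, h3]
  rcases neg_one_pow_eq_or ℤ k with h | h <;> simp [h]

theorem coeff_zero_plasticAbove {n : ℕ} (hn : Odd n) :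
    (plasticAbove n).coeff 0 = 1 ∨ (plasticAbove n).coeff 0 = -1 := by
  obtain ⟨k, rfl⟩ := hn
  have h0 := (eval_zero_S_two_mul k).2
  have h2 := (eval_zero_S_two_mul (k + 1)).2
  have h3 := (eval_zero_S_two_mul (k + 2)).1
  have h4 := (eval_zero_S_two_mul (k + 2)).2
  have e2 : ((2 * k + 1 : ℕ) : ℤ) + 2 = (2 * (k + 1) + 1 : ℕ) := by push_cast; ring
  have e3 : ((2 * k + 1 : ℕ) : ℤ) + 3 = (2 * (k + 2) : ℕ) := by push_cast; ring
  have e4 : ((2 * k + 1 : ℕ) : ℤ) + 4 = (2 * (k + 2) + 1 : ℕ) := by push_cast; ring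
  rw [coeff_zero_eq_eval_zero, plasticAbove, e4, e3, e2]
  simp only [eval_sub, eval_add, h0, h2, h3, h4]
  rcases neg_one_pow_eq_or ℤ k with h | h <;> simp [h, pow_add]

theorem coeff_zero_coxeterEven {n : ℕ} (hn : Even n) :
    (coxeterEven n).coeff 0 = 1 ∨ (coxeterEven n).coeff 0 = -1 := by
  obtain ⟨k, rfl⟩ := hn
  have h0 := (eval_zero_S_two_mul k).1
  have h1 := (eval_zero_S_two_mul k).2
  have h2 := (eval_zero_S_two_mul (k + 1)).1
  have h3 := (eval_zero_S_two_mul (k + 1)).2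
  have h4 := (eval_zero_S_two_mul (k + 2)).1
  have e0 : ((k + k : ℕ) : ℤ) = (2 * k : ℕ) := by push_cast; ring
  have e1 : ((k + k : ℕ) : ℤ) + 1 = (2 * k + 1 : ℕ) := by push_cast; ring
  have e2 : ((k + k : ℕ) : ℤ) + 2 = (2 * (k + 1) : ℕ) := by push_cast; ring
  have e3 : ((k + k : ℕ) : ℤ) + 3 = (2 * (k + 1) + 1 : ℕ) := by push_cast; ring
  have e4 : ((k + k : ℕ) : ℤ) + 4 = (2 * (k + 2) : ℕ) := by push_cast; ring
  rw [coeff_zero_eq_eval_zero, coxeterEven, e4, e3, e2, e1, e0]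
  simp only [eval_sub, eval_add, eval_mul, h0, h1, h2, h3, h4]
  rcases neg_one_pow_eq_or ℤ k with h | h <;> simp [h, pow_add]

/-! Roots of unity whose trace is a root. -/

theorem aeval_coxeterOdd {R : Type*} [CommRing R] (x : R) (n : ℕ) : aeval x (coxeterOdd n) =
    (x + 1) * (S R (n + 2)).eval x - (x + 2) * (S R (n + 1)).eval x := by
  simp [coxeterOdd_eq, aeval_S, map_ofNat]

theorem aeval_plasticAbove {R : Type*} [CommRing R] (x : R) (n : ℕ) : aeval x (plasticAbove n) =
    (x ^ 2 - x - 3) * (S R (n + 2)).eval x + (S R (n + 1)).eval x := by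
  simp [plasticAbove_eq, aeval_S, map_ofNat]

theorem aeval_coxeterEven {R : Type*} [CommRing R] (x : R) (n : ℕ) : aeval x (coxeterEven n) =
    (2 * x + 3) * (S R (n + 3)).eval x - (x + 1) ^ 2 * (S R (n + 2)).eval x := by
  simp [coxeterEven_eq, aeval_S, map_ofNat]

theorem pow_mul_plastic_of_aeval_coxeterOdd {n : ℕ} {t : ℂ} (ht : t ≠ 0)
    (h : aeval (t + t⁻¹) (coxeterOdd n) = 0) :
    t ^ (2 * n + 5) * (t ^ 3 - t - 1) = -(t ^ 3 + t ^ 2 - 1) := by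
  rw [aeval_coxeterOdd] at h
  have h2 := pow_mul_eval_S ht (n + 2)
  have h1 := pow_mul_eval_S ht (n + 1)
  push_cast at h1 h2
  have hx : t * (t + t⁻¹) = t ^ 2 + 1 := by field_simp
  linear_combination t ^ (n + 3) * (t ^ 2 - 1) * h - (t ^ 2 + t + 1) * h2 +
    t * (t + 1) ^ 2 * h1 - t ^ (n + 2) * (t ^ 2 - 1) *
      ((S ℂ (n + 2)).eval (t + t⁻¹) - (S ℂ (n + 1)).eval (t + t⁻¹)) * hx

/-- The closed form of `S` carries a factor t² - 1, of which the division by t + 1 absorbs only one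
half; t - 1 must be cancelled. -/
theorem pow_mul_plastic_of_aeval_plasticAbove {n : ℕ} {t : ℂ} (ht : t ≠ 0) (ht1 : t ≠ 1)
    (h : aeval (t + t⁻¹) (plasticAbove n) = 0) :
    t ^ (2 * n + 6) * (t ^ 3 - t - 1) = t ^ 3 + t ^ 2 - 1 := by
  rw [aeval_plasticAbove] at h
  have h2 := pow_mul_eval_S ht (n + 2)
  have h1 := pow_mul_eval_S ht (n + 1)
  push_cast at h1 h2
  have hx : t * (t + t⁻¹) = t ^ 2 + 1 := by field_simp
  apply mul_left_cancel₀ (sub_ne_zero.2 ht1)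
  linear_combination t ^ (n + 4) * (t ^ 2 - 1) * h -
    ((t ^ 2 + 1) ^ 2 - t * (t ^ 2 + 1) - 3 * t ^ 2) * h2 - t ^ 3 * h1 -
    t ^ (n + 2) * (t ^ 2 - 1) * (S ℂ (n + 2)).eval (t + t⁻¹) *
      (t * (t + t⁻¹) + t ^ 2 + 1 - t) * hx

theorem pow_mul_plastic_of_aeval_coxeterEven {n : ℕ} {t : ℂ} (ht : t ≠ 0) (ht1 : t ≠ -1)
    (h : aeval (t + t⁻¹) (coxeterEven n) = 0) :
    t ^ (2 * n + 6) * (t ^ 3 - t - 1) = -(t ^ 3 + t ^ 2 - 1) := by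
  rw [aeval_coxeterEven] at h
  have h2 := pow_mul_eval_S ht (n + 3)
  have h1 := pow_mul_eval_S ht (n + 2)
  push_cast at h1 h2
  have hx : t * (t + t⁻¹) = t ^ 2 + 1 := by field_simp
  apply mul_left_cancel₀ (a := t + 1) (fun h => ht1 (eq_neg_of_add_eq_zero_left h))
  linear_combination t ^ (n + 4) * (t ^ 2 - 1) * h -
    (2 * (t ^ 2 + 1) + 3 * t) * h2 + (t ^ 2 + t + 1) ^ 2 * h1 -
    t ^ (n + 2) * (t ^ 2 - 1) * (2 * t * (S ℂ (n + 3)).eval (t + t⁻¹) -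
      (S ℂ (n + 2)).eval (t + t⁻¹) * (t * (t + t⁻¹) + t ^ 2 + 1 + 2 * t)) * hx

theorem aeval_two_coxeterOdd (n : ℕ) : aeval (2 : ℂ) (coxeterOdd n) = 1 - n := by
  rw [aeval_coxeterOdd, S_eval_two, S_eval_two]; push_cast; ring

theorem aeval_neg_two_coxeterOdd {R : Type*} [CommRing R] (n : ℕ) :
    aeval (-2 : R) (coxeterOdd n) = (-1) ^ (n + 3) * (n + 3) := by
  have := eval_neg_two_S_natCast (R := R) (n + 2)
  push_cast at this
  rw [aeval_coxeterOdd, this]; ring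

theorem aeval_two_plasticAbove {R : Type*} [CommRing R] (n : ℕ) :
    aeval (2 : R) (plasticAbove n) = -1 := by
  rw [aeval_plasticAbove, S_eval_two, S_eval_two]; push_cast; ring

theorem aeval_neg_two_plasticAbove {R : Type*} [CommRing R] (n : ℕ) :
    aeval (-2 : R) (plasticAbove n) = (-1) ^ (n + 4) * (2 * n + 7) := by
  have h2 := eval_neg_two_S_natCast (R := R) (n + 2)
  have h1 := eval_neg_two_S_natCast (R := R) (n + 1)
  push_cast at h1 h2
  rw [aeval_plasticAbove, h1, h2]; ring

theorem aeval_two_coxeterEven (n : ℕ) : aeval (2 : ℂ) (coxeterEven n) = 1 - 2 * n := by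
  rw [aeval_coxeterEven, S_eval_two, S_eval_two]; push_cast; ring

theorem aeval_neg_two_coxeterEven {R : Type*} [CommRing R] (n : ℕ) :
    aeval (-2 : R) (coxeterEven n) = (-1) ^ n := by
  have h2 := eval_neg_two_S_natCast (R := R) (n + 2)
  have h3 := eval_neg_two_S_natCast (R := R) (n + 3)
  push_cast at h2 h3
  rw [aeval_coxeterEven, h3, h2]; ring

theorem rootOfUnity_cases_coxeterOdd {ζ : ℂ} {n N : ℕ} (hn : n ≠ 1) (hN : 0 < N) (hζ : ζ ^ N = 1)
    (h : aeval (ζ + ζ⁻¹) (coxeterOdd n) = 0) :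
    (ζ ^ 2 + ζ + 1 = 0 ∧ (2 * n + 5) % 3 = 1) ∨
    (ζ ^ 4 + ζ ^ 3 + ζ ^ 2 + ζ + 1 = 0 ∧ (2 * n + 5) % 5 = 2) ∨
    (ζ ^ 4 + 1 = 0 ∧ (2 * n + 5) % 8 = 3) ∨
    (ζ ^ 6 - ζ ^ 3 + 1 = 0 ∧ (2 * n + 5) % 18 = 5) := by
  have hζ0 : ζ ≠ 0 := by rintro rfl; simp [hN.ne'] at hζ
  refine (rootOfUnity_cases_odd_neg hN hζ ⟨n + 2, by ring⟩
    (pow_mul_plastic_of_aeval_coxeterOdd hζ0 h)).resolve_left fun h1 => ?_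
  rcases mul_self_eq_one_iff.1 (sq ζ ▸ h1) with rfl | rfl
  -- The value at the trace 2 is 1 - n; n = 1 is the affine diagram E₉.
  · norm_num [aeval_two_coxeterOdd, sub_eq_zero] at h
    exact hn (by exact_mod_cast h.symm)
  · norm_num [aeval_neg_two_coxeterOdd] at h
    norm_cast at h

theorem rootOfUnity_cases_plasticAbove {ζ : ℂ} {n N : ℕ} (hN : 0 < N) (hζ : ζ ^ N = 1)
    (h : aeval (ζ + ζ⁻¹) (plasticAbove n) = 0) :
    (2 * n + 6) % 12 = 10 ∨ (2 * n + 6) % 18 = 14 := by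
  have hζ0 : ζ ≠ 0 := by rintro rfl; simp [hN.ne'] at hζ
  have hζ1 : ζ ≠ 1 := by
    rintro rfl
    norm_num [aeval_two_plasticAbove] at h
  have hζ2 : ζ ≠ -1 := by
    rintro rfl
    norm_num [aeval_neg_two_plasticAbove] at h
    norm_cast at h
  rcases rootOfUnity_cases_even_pos hN hζ ⟨n + 3, by ring⟩
    (pow_mul_plastic_of_aeval_plasticAbove hζ0 hζ1 h) with h1 | h1 | h1
  · rcases mul_self_eq_one_iff.1 (sq ζ ▸ h1) with h2 | h2 <;> contradiction
  · exact Or.inl h1.2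
  · exact Or.inr h1.2

theorem rootOfUnity_cases_coxeterEven {ζ : ℂ} {n N : ℕ} (hN : 0 < N) (hζ : ζ ^ N = 1)
    (h : aeval (ζ + ζ⁻¹) (coxeterEven n) = 0) :
    ζ ^ 2 + ζ + 1 = 0 ∨ (2 * n + 6) % 5 = 2 ∨ (2 * n + 6) % 12 = 4 ∨ (2 * n + 6) % 30 = 6 := by
  have hζ0 : ζ ≠ 0 := by rintro rfl; simp [hN.ne'] at hζ
  have hζ1 : ζ ≠ 1 := by
    rintro rfl
    norm_num [aeval_two_coxeterEven, sub_eq_zero] at h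
    norm_cast at h
    omega
  have hζ2 : ζ ≠ -1 := by
    rintro rfl
    norm_num [aeval_neg_two_coxeterEven] at h
  rcases rootOfUnity_cases_even_neg hN hζ ⟨n + 3, by ring⟩
    (pow_mul_plastic_of_aeval_coxeterEven hζ0 hζ2 h) with h1 | h1 | h1 | h1 | h1
  · rcases mul_self_eq_one_iff.1 (sq ζ ▸ h1) with h2 | h2 <;> contradiction
  · exact Or.inl h1.1
  · exact Or.inr (Or.inl h1.2)
  · exact Or.inr (Or.inr (Or.inl h1.2))
  · exact Or.inr (Or.inr (Or.inr h1.2))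

/-! ### Sign patterns at the Chebyshev nodes -/

/-- The node `2 cos (j π / N)`. -/
noncomputable def chebNode (N j : ℕ) : ℝ := 2 * Real.cos (j * Real.pi / N)

theorem chebNode_lt {N i j : ℕ} (hN : 0 < N) (hij : i < j) (hj : j ≤ N) :
    chebNode N j < chebNode N i := by
  have hN' : (0 : ℝ) < N := by exact_mod_cast hN
  have hij' : (i : ℝ) < j := by exact_mod_cast hij
  have hj' : (j : ℝ) ≤ N := by exact_mod_cast hj
  refine mul_lt_mul_of_pos_left (Real.cos_lt_cos_of_nonneg_of_le_pi (by positivity) ?_ ?_) two_pos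
  · rw [div_le_iff₀ hN', mul_comm]
    exact mul_le_mul_of_nonneg_left hj' Real.pi_pos.le
  · gcongr

theorem chebNode_zero (N : ℕ) : chebNode N 0 = 2 := by simp [chebNode]

theorem chebNode_self {N : ℕ} (hN : 0 < N) : chebNode N N = -2 := by
  have hN' : (N : ℝ) ≠ 0 := by exact_mod_cast hN.ne'
  rw [chebNode, mul_div_cancel_left₀ _ hN', Real.cos_pi]; norm_num

theorem chebNode_two_thirds {k : ℕ} (hk : 0 < k) : chebNode (3 * k) (2 * k) = -1 := by
  have hk' : (k : ℝ) ≠ 0 := by exact_mod_cast hk.ne'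
  rw [chebNode, show ((2 * k : ℕ) : ℝ) * Real.pi / (3 * k : ℕ) = Real.pi - Real.pi / 3 by
    push_cast; field_simp; ring, Real.cos_pi_sub, Real.cos_pi_div_three]
  norm_num

theorem eval_S_chebNode {n j : ℕ} (hj : 1 ≤ j) (hjn : j ≤ n + 1) :
    (S ℝ (n + 1)).eval (chebNode (n + 2) j) = 0 ∧
    (S ℝ n).eval (chebNode (n + 2) j) = (-1) ^ (j + 1) := by
  have := eval_S_zeros n j hj hjn
  rw [chebNode]; push_cast; exact this

theorem neg_one_pow_mul_self (j : ℕ) : (-1 : ℝ) ^ j * (-1) ^ j = 1 := by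
  rw [← mul_pow]; norm_num

/-- At the j-th zero x of `S (n + 2)` the value is (-1)^j (x + 2), so the signs alternate; 2.08 and
-2 complete the list. -/
theorem coxeterOdd_irreducible_and_roots {n : ℕ} (hn : n ≠ 1) (h3 : (2 * n + 5) % 3 ≠ 1)
    (h5 : (2 * n + 5) % 5 ≠ 2) (h8 : (2 * n + 5) % 8 ≠ 3) (h18 : (2 * n + 5) % 18 ≠ 5) :
    Irreducible (coxeterOdd n) ∧ ∀ z : ℂ, aeval z (coxeterOdd n) = 0 →
      ∃ r : ℝ, r ∈ Set.Ioo (-2.08 : ℝ) 2.08 ∧ z = (r : ℂ) := by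
  have hN : 0 < n + 3 := by omega
  have hlt : chebNode (n + 3) 1 < 2 := chebNode_zero (n + 3) ▸ chebNode_lt hN one_pos (by omega)
  refine irreducible_and_roots_of_alternating hN (monic_coxeterOdd n).1 (monic_coxeterOdd n).2
    (fun i => Nat.casesOn i 2.08 fun i => chebNode (n + 3) (i + 1)) rfl hlt.le
    (chebNode_self hN) ?_ ?_ ?_
  · rintro (_ | i) hi
    · change chebNode (n + 3) 1 < 2.08
      linarith
    · exact chebNode_lt hN (by omega) (by omega)
  · rintro (_ | i) hi
    · change 0 < (-1) ^ 0 * aeval (2.08 : ℝ) (coxeterOdd n)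
      have h := eval_S_growth_upper (n + 1)
      push_cast at h
      rw [show (n : ℤ) + 1 + 1 = n + 2 by ring] at h
      rw [aeval_coxeterOdd]
      linarith
    · change 0 < (-1) ^ (i + 1) * aeval (chebNode (n + 3) (i + 1)) (coxeterOdd n)
      rcases (show i + 1 < n + 3 ∨ i + 1 = n + 3 by omega) with hi' | hi'
      · have h := eval_S_chebNode (n := n + 1) (j := i + 1) (by omega) (by omega)
        have hpos := chebNode_lt hN hi' le_rfl
        rw [chebNode_self hN] at hpos
        push_cast at h
        rw [show (n : ℤ) + 1 + 1 = n + 2 by ring] at h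
        rw [aeval_coxeterOdd, h.1, h.2]
        have := neg_one_pow_mul_self (i + 1)
        rw [pow_succ (-1 : ℝ) (i + 1)]
        nlinarith
      · rw [hi', chebNode_self hN, aeval_neg_two_coxeterOdd, ← mul_assoc, neg_one_pow_mul_self]
        positivity
  · intro ζ N hN hζ h
    rcases rootOfUnity_cases_coxeterOdd hn hN hζ h with h | h | h | h
    · exact h3 h.2
    · exact h5 h.2
    · exact h8 h.2
    · exact h18 h.2

theorem plasticAbove_irreducible_and_roots {n : ℕ} (hn : 9 ≤ n) (h12 : (2 * n + 6) % 12 ≠ 10)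
    (h18 : (2 * n + 6) % 18 ≠ 14) :
    Irreducible (plasticAbove n) ∧ ∀ z : ℂ, aeval z (plasticAbove n) = 0 →
      ∃ r : ℝ, r ∈ Set.Ioo (-2.08 : ℝ) 2.08 ∧ z = (r : ℂ) := by
  have hN : 0 < n + 3 := by omega
  refine irreducible_and_roots_of_alternating (Nat.succ_pos _) (monic_plasticAbove n).1
    -- The degree is one more than the number of nodes below 2, so the node 2 itself, where the
    -- value is -1, is included.
    (monic_plasticAbove n).2 (fun i => Nat.casesOn i 2.08 fun i => chebNode (n + 3) i) rfl
    (chebNode_zero _).le (chebNode_self hN) ?_ ?_ ?_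
  · rintro (_ | i) hi
    · change chebNode (n + 3) 0 < 2.08
      rw [chebNode_zero]; norm_num
    · exact chebNode_lt hN (by omega) (by omega)
  · rintro (_ | i) hi
    · change 0 < (-1) ^ 0 * aeval (2.08 : ℝ) (plasticAbove n)
      obtain ⟨m, rfl⟩ : ∃ m, n = m + 9 := ⟨n - 9, by omega⟩
      have h := eval_S_growth_lower m
      rw [aeval_plasticAbove]
      push_cast
      rw [show (m : ℤ) + 9 + 2 = m + 11 by ring, show (m : ℤ) + 9 + 1 = m + 10 by ring]
      linarith
    · change 0 < (-1) ^ (i + 1) * aeval (chebNode (n + 3) i) (plasticAbove n)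
      rcases (show i = 0 ∨ 0 < i ∧ i < n + 3 ∨ i = n + 3 by omega) with rfl | ⟨h0, hi'⟩ | hi'
      · rw [chebNode_zero, aeval_two_plasticAbove]; norm_num
      · have h := eval_S_chebNode (n := n + 1) (j := i) h0 (by omega)
        push_cast at h
        rw [show (n : ℤ) + 1 + 1 = n + 2 by ring] at h
        rw [aeval_plasticAbove, h.1, h.2, mul_zero, zero_add, neg_one_pow_mul_self]
        exact one_pos
      · rw [hi', chebNode_self hN, aeval_neg_two_plasticAbove, ← mul_assoc, neg_one_pow_mul_self]
        positivity
  · intro ζ N hN hζ h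
    rcases rootOfUnity_cases_plasticAbove hN hζ h with h | h
    · exact h12 h
    · exact h18 h

/-! ### The even Coxeter family with its factor X + 1 removed -/

theorem eval_neg_one_S_three_mul (k : ℕ) :
    (S ℤ (3 * k)).eval (-1) = 1 ∧ (S ℤ (3 * k + 1)).eval (-1) = -1 ∧
    (S ℤ (3 * k + 2)).eval (-1) = 0 ∧ (derivative (S ℤ (3 * k))).eval (-1) = k ∧
    (derivative (S ℤ (3 * k + 1))).eval (-1) = k + 1 ∧
    (derivative (S ℤ (3 * k + 2))).eval (-1) = -2 * (k + 1) := by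
  have step : ∀ a : ℤ,
      (S ℤ (a + 2)).eval (-1) = -(S ℤ (a + 1)).eval (-1) - (S ℤ a).eval (-1) ∧
      (derivative (S ℤ (a + 2))).eval (-1) = (S ℤ (a + 1)).eval (-1) -
        (derivative (S ℤ (a + 1))).eval (-1) - (derivative (S ℤ a)).eval (-1) := by
    intro a
    rw [S_add_two]
    constructor
    · simp
    · simp; ring
  suffices h : (S ℤ (3 * k)).eval (-1) = 1 ∧ (S ℤ (3 * k + 1)).eval (-1) = -1 ∧
      (derivative (S ℤ (3 * k))).eval (-1) = k ∧
      (derivative (S ℤ (3 * k + 1))).eval (-1) = k + 1 by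
    obtain ⟨h0, h1, d0, d1⟩ := h
    have h2 := step (3 * k)
    rw [h0, h1, d0, d1] at h2
    exact ⟨h0, h1, by rw [h2.1]; ring, d0, d1, by rw [h2.2]; ring⟩
  induction k with
  | zero => simp
  | succ k ih =>
    obtain ⟨h0, h1, d0, d1⟩ := ih
    have h2 := step (3 * k)
    have h3 := step (3 * k + 1)
    have h4 := step (3 * k + 2)
    push_cast
    rw [show (3 * k : ℤ) + 1 + 1 = 3 * k + 2 by ring] at h3
    rw [show (3 * k : ℤ) + 2 + 1 = 3 * k + 1 + 2 by ring] at h4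
    rw [show 3 * ((k : ℤ) + 1) = 3 * k + 1 + 2 by ring,
      show (3 * k : ℤ) + 1 + 2 + 1 = 3 * k + 2 + 2 by ring, h3.1, h3.2, h4.1, h4.2, h3.1, h3.2,
      h2.1, h2.2, h0, h1, d0, d1]
    refine ⟨?_, ?_, ?_, ?_⟩ <;> ring

/-- `T` is the trace polynomial of the Coxeter polynomial `E_{6k}` divided by `t ^ 2 + t + 1`. -/
theorem exists_coxeterEven_factor {n k : ℕ} (hk : n + 4 = 3 * k) :
    ∃ T : ℤ[X], coxeterEven n = (X + 1) * T ∧ T.eval (-1) ≠ 0 := by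
  obtain ⟨l, rfl⟩ : ∃ l, k = l + 1 := ⟨k - 1, by omega⟩
  obtain ⟨-, -, h2, -, -, d2⟩ := eval_neg_one_S_three_mul l
  have e : (n : ℤ) + 3 = 3 * l + 2 := by omega
  have hroot : (coxeterEven n).eval (-1) = 0 := by
    simp [coxeterEven_eq, e, h2, -S_add_two]
  obtain ⟨T, hT⟩ := dvd_iff_isRoot.2 hroot
  rw [Polynomial.C_neg, Polynomial.C_1, sub_neg_eq_add] at hT
  refine ⟨T, hT, fun h0 => ?_⟩
  -- The root -1 is simple: the derivative there is that of `S (3l + 2)`, namely -2(l + 1), and it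
  -- equals T(-1).
  have h := congrArg (fun P => (derivative P).eval (-1)) hT
  rw [coxeterEven_eq, e] at h
  simp [h2, d2, h0, sq, -S_add_two] at h
  omega

theorem coxeterEven_factor_irreducible_and_roots {n k : ℕ} {T : ℤ[X]} (hk : n + 4 = 3 * k)
    (hn : Even n) (hT : coxeterEven n = (X + 1) * T) (hT1 : T.eval (-1) ≠ 0)
    (h5 : (2 * n + 6) % 5 ≠ 2) (h12 : (2 * n + 6) % 12 ≠ 4) (h30 : (2 * n + 6) % 30 ≠ 6) :
    T.Monic ∧ T.natDegree = n + 3 ∧ Irreducible T ∧ ∀ z : ℂ, aeval z T = 0 →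
      ∃ r : ℝ, r ∈ Set.Ioo (-2.08 : ℝ) 2.08 ∧ z = (r : ℂ) := by
  have hX : (X + 1 : ℤ[X]).Monic := monic_X_add_C 1
  have hmonic : T.Monic := hX.of_mul_monic_left (hT ▸ (monic_coxeterEven n).1)
  have hdeg : T.natDegree = n + 3 := by
    have h := (monic_coxeterEven n).2
    have hX1 : (X + 1 : ℤ[X]).natDegree = 1 := natDegree_X_add_C 1
    rw [hT, hX.natDegree_mul hmonic, hX1] at h
    omega
  refine ⟨hmonic, hdeg, ?_⟩
  have hTx : ∀ x : ℝ, (x + 1) * aeval x T = aeval x (coxeterEven n) := fun x => by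
    simp [hT]
  have hN : 0 < n + 4 := by omega
  have hk0 : 0 < k := by omega
  have hmid : chebNode (n + 4) (2 * k) = -1 := hk ▸ chebNode_two_thirds hk0
  have hlt : chebNode (n + 4) 1 < 2 := chebNode_zero (n + 4) ▸ chebNode_lt hN one_pos (by omega)
  have hnode : ∀ j, 1 ≤ j → j ≤ n + 3 → j ≠ 2 * k →
      aeval (chebNode (n + 4) j) T = (chebNode (n + 4) j + 1) * (-1) ^ j := by
    intro j hj1 hj hjk
    have hne : chebNode (n + 4) j + 1 ≠ 0 := by
      rcases lt_or_gt_of_ne hjk with h | h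
      · have := chebNode_lt hN h (by omega)
        rw [hmid] at this
        linarith
      · have := chebNode_lt hN h (by omega)
        rw [hmid] at this
        linarith
    have h := eval_S_chebNode (n := n + 2) hj1 hj
    push_cast at h
    rw [show (n : ℤ) + 2 + 1 = n + 3 by ring] at h
    apply mul_left_cancel₀ hne
    rw [hTx, aeval_coxeterEven, h.1, h.2]
    ring
  -- At the j-th node x, T has the sign of (x + 1)(-1)^j, which loses its alternation across x = -1.
  -- Skipping the node of index 2k, which is -1, restores it.
  obtain ⟨σ, hσ⟩ : ∃ σ : ℕ → ℕ, ∀ i, σ i = if i + 1 < 2 * k then i + 1 else i + 2 := ⟨_, fun _ => rfl⟩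
  have hσ0 : σ 0 = 1 := by rw [hσ, if_pos (by omega)]
  have hσn : σ (n + 2) = n + 4 := by rw [hσ, if_neg (by omega)]
  refine irreducible_and_roots_of_alternating (Nat.succ_pos _) hmonic hdeg
    (fun i => Nat.casesOn i 2.08 fun i => chebNode (n + 4) (σ i)) rfl ?_ ?_ ?_ ?_ ?_
  · change chebNode (n + 4) (σ 0) ≤ 2
    rw [hσ0]; exact hlt.le
  · change chebNode (n + 4) (σ (n + 2)) = -2
    rw [hσn, chebNode_self hN]
  · rintro (_ | i) hi
    · change chebNode (n + 4) (σ 0) < 2.08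
      rw [hσ0]; linarith
    · refine chebNode_lt hN ?_ ?_ <;> rw [hσ]
      · rw [hσ]; split_ifs <;> omega
      · split_ifs <;> omega
  · rintro (_ | i) hi
    · change 0 < (-1) ^ 0 * aeval (2.08 : ℝ) T
      have h := eval_S_growth_upper (n + 2)
      push_cast at h
      rw [show (n : ℤ) + 2 + 1 = n + 3 by ring] at h
      have h1 := hTx 2.08
      rw [aeval_coxeterEven] at h1
      linarith
    · change 0 < (-1) ^ (i + 1) * aeval (chebNode (n + 4) (σ i)) T
      rcases (show i = n + 2 ∨ i < n + 2 by omega) with rfl | hi'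
      · rw [hσn, chebNode_self hN]
        have h1 := hTx (-2)
        rw [aeval_neg_two_coxeterEven, hn.neg_one_pow] at h1
        rw [Odd.neg_one_pow (by obtain ⟨l, rfl⟩ := hn; exact ⟨l + 1, by ring⟩)]
        linarith
      · rcases lt_or_ge (i + 1) (2 * k) with h | h
        · rw [hσ, if_pos h, hnode _ (by omega) (by omega) h.ne]
          have h1 := chebNode_lt hN h (by omega)
          rw [hmid] at h1
          rw [mul_left_comm, neg_one_pow_mul_self]
          linarith
        · rw [hσ, if_neg h.not_gt, hnode _ (by omega) (by omega) (by omega)]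
          have h1 := chebNode_lt hN (show 2 * k < i + 2 by omega) (by omega)
          rw [hmid] at h1
          rw [mul_left_comm, pow_succ (-1 : ℝ) (i + 1), ← mul_assoc ((-1 : ℝ) ^ (i + 1)),
            neg_one_pow_mul_self]
          linarith
  · intro ζ N hN hζ h
    have hζ0 : ζ ≠ 0 := by rintro rfl; simp [hN.ne'] at hζ
    rcases rootOfUnity_cases_coxeterEven hN hζ (by rw [hT, map_mul, h, mul_zero]) with h1 | h1 | h1 | h1
    · have hx : ζ + ζ⁻¹ = ((-1 : ℤ) : ℂ) := by
        push_cast; field_simp; linear_combination h1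
      rw [hx, ← eq_intCast (algebraMap ℤ ℂ), aeval_algebraMap_apply] at h
      simp at h
      exact hT1 h
    · exact h5 h1
    · exact h12 h1
    · exact h30 h1

/-! ### The case of degree seven -/

theorem coxeterOdd_seven : coxeterOdd 7 = (X + 1) * (X ^ 2 - 2) *
    (X ^ 7 - X ^ 6 - 7 * X ^ 5 + 6 * X ^ 4 + 13 * X ^ 3 - 9 * X ^ 2 - 3 * X + 1) := by
  have h : ∀ k : ℕ, S ℤ (k + 2) = X * S ℤ (k + 1) - S ℤ k := fun k => S_add_two ℤ k
  have h2 := h 0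
  have h3 := h 1
  have h4 := h 2
  have h5 := h 3
  have h6 := h 4
  have h7 := h 5
  have h8 := h 6
  have h9 := h 7
  have h10 := h 8
  norm_num at h2 h3 h4 h5 h6 h7 h8 h9 h10
  rw [coxeterOdd]
  norm_num
  rw [h10, h9, h8, h7, h6, h5, h4, h3, S_two]
  ring

theorem degree_seven_irreducible_and_roots {T : ℤ[X]}
    (hT : T = X ^ 7 - X ^ 6 - 7 * X ^ 5 + 6 * X ^ 4 + 13 * X ^ 3 - 9 * X ^ 2 - 3 * X + 1) :
    T.Monic ∧ T.natDegree = 7 ∧ Irreducible T ∧ ∀ z : ℂ, aeval z T = 0 →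
      ∃ r : ℝ, r ∈ Set.Ioo (-2.08 : ℝ) 2.08 ∧ z = (r : ℂ) := by
  have hmonic : T.Monic := by rw [hT]; monicity!
  have hdeg : T.natDegree = 7 := by rw [hT]; compute_degree!
  have hev : ∀ {R : Type} [CommRing R] (x : R), aeval x T =
      x ^ 7 - x ^ 6 - 7 * x ^ 5 + 6 * x ^ 4 + 13 * x ^ 3 - 9 * x ^ 2 - 3 * x + 1 := by
    intro R _ x
    simp [hT, map_ofNat]
  refine ⟨hmonic, hdeg, irreducible_and_roots_of_alternating (by norm_num) hmonic hdeg
    (fun i => ([2.08, 2, 1, 0.5, 0, -1, -1.8, -2] : List ℝ).getD i 0) ?_ ?_ ?_ ?_ ?_ ?_⟩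
  · simp
  · simp
  · simp
  · intro i hi
    interval_cases i <;> norm_num
  · intro i hi
    rw [hev]
    interval_cases i <;> norm_num
  · intro ζ N hN hζ h
    have hζ0 : ζ ≠ 0 := by rintro rfl; simp [hN.ne'] at hζ
    have h' : aeval (ζ + ζ⁻¹) (coxeterOdd 7) = 0 := by
      rw [coxeterOdd_seven, ← hT, map_mul, h, mul_zero]
    rcases rootOfUnity_cases_coxeterOdd (by norm_num) hN hζ h' with h1 | h1 | h1 | h1
    · have hx : ζ + ζ⁻¹ = -1 := by
        field_simp; linear_combination h1.1
      rw [hx, hev] at h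
      norm_num at h
    · exact absurd h1.2 (by norm_num)
    · have hx : (ζ + ζ⁻¹) ^ 2 = 2 := by
        field_simp; linear_combination h1.1
      rw [hev] at h
      generalize ζ + ζ⁻¹ = x at h hx
      -- Modulo x² - 2 the septic reduces to 3x - 1, and (3x - 1)(3x + 1) = 17.
      have h2 : (17 : ℂ) = 0 := by
        linear_combination (3 * x + 1) * h - ((3 * x + 1) * (x ^ 5 - x ^ 4 - 5 * x ^ 3 + 4 * x ^ 2 + 3 * x - 1) + 9) * hx
      norm_num at h2
    · exact absurd h1.2 (by norm_num)

/-! ### Choice of the family by residues of the prime -/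

theorem proposition5p9 (p : ℕ) (hp : p.Prime) (hp3 : 3 < p) :
    ∃ T : Polynomial ℤ,
      T.Monic ∧ Irreducible T ∧ T.natDegree = p ∧
      (T.coeff 0 = 1 ∨ T.coeff 0 = -1) ∧
      ∀ z : ℂ, Polynomial.aeval z T = 0 →
        ∃ r : ℝ, r ∈ Set.Ioo (-2.08 : ℝ) 2.08 ∧ z = (r : ℂ) := by
  have hodd : p % 2 = 1 := Nat.odd_iff.1 (hp.odd_of_ne_two (by omega))
  have hmod3 : p % 3 ≠ 0 := fun h => by
    have := (Nat.prime_dvd_prime_iff_eq Nat.prime_three hp).1 (Nat.dvd_of_mod_eq_zero h)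
    omega
  -- Here `plasticAbove 3` is negative at 2.08, so its largest root is too big, and `coxeterOdd 4`
  -- has the root -1.
  by_cases h7 : p = 7
  · obtain ⟨h1, h2, h3, h4⟩ := degree_seven_irreducible_and_roots rfl
    exact ⟨_, h1, h3, h2.trans h7.symm, Or.inl (by simp [coeff_X, coeff_one]), h4⟩
  by_cases h1 : p % 3 = 1
  · obtain ⟨n, rfl⟩ : ∃ n, p = n + 4 := ⟨p - 4, by omega⟩
    obtain ⟨h3, h4⟩ := plasticAbove_irreducible_and_roots (n := n) (by omega) (by omega) (by omega)
    exact ⟨_, (monic_plasticAbove n).1, h3, (monic_plasticAbove n).2,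
      coeff_zero_plasticAbove (Nat.odd_iff.2 (by omega)), h4⟩
  obtain ⟨n, rfl⟩ : ∃ n, p = n + 3 := ⟨p - 3, by omega⟩
  -- For p ≡ 2 mod 3 the order 5 is the only obstruction to `coxeterOdd` left; it occurs when 2n + 5
  -- ≡ 2 mod 5, that is, p ≡ 4 mod 5.
  by_cases h5 : (n + 3) % 5 = 4
  · obtain ⟨k, hk⟩ : ∃ k, n + 4 = 3 * k := ⟨(n + 4) / 3, by omega⟩
    have hn : Even n := Nat.even_iff.2 (by omega)
    obtain ⟨T, hT, hT1⟩ := exists_coxeterEven_factor hk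
    obtain ⟨h2, h3, h4, h6⟩ := coxeterEven_factor_irreducible_and_roots hk hn hT hT1
      (by omega) (by omega) (by omega)
    refine ⟨T, h2, h4, h3, ?_, h6⟩
    have h := coeff_zero_coxeterEven hn
    rw [hT, mul_coeff_zero] at h
    simpa using h
  · obtain ⟨h3, h4⟩ := coxeterOdd_irreducible_and_roots (n := n) (by omega) (by omega) (by omega)
      (by omega) (by omega)
    exact ⟨_, (monic_coxeterOdd n).1, h3, (monic_coxeterOdd n).2,
      coeff_zero_coxeterOdd (Nat.even_iff.2 (by omega)), h4⟩
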